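/- **Setting.** Let $\mathcal V$ be a finite set. For a tree $\mathcal T=(\mathcal V,\mathcal E)$ rooted at $r\in\mathcal V$ (written $\mathcal T_r$), let $\mathrm{dsc}(v)$ be the set of vertices $j\ne v$ such that $v$ lies on the path from $j$ to $r$, let $\mathrm{ch}(v)$ be the set of elements of $\mathrm{dsc}(v)$ adjacent to $v$ (the children of $v$), and let $\mathrm{pa}(v)$ be the vertex of which $v\neq r$ is a child. For edge parameters $\boldsymbol\alpha=(\alpha_e)_{e\in\mathcal E}\in[0,1]^{\mathcal E}$ and $\lambda>0$, a random vector $\boldsymbol N=(N_v)_{v\in\mathcal V}$ with values in $\mathbb N^{\mathcal V}$ is said to be $\mathrm{MPMRF}(\lambda,\boldsymbol\alpha,\mathcal T)$ if, for some choice of a root $r$, it has the joint distribution of the vector defined by $$N_r=L_r,\qquad N_v=L_v+\sum_{i=1}^{N_{\mathrm{pa}(v)}} I_{v,i}\quad(v\ne r),$$ where all variables $L_v$, $I_{v,i}$ ($v\in\mathcal V$, $i\ge1$) are independent, $L_r\sim\mathrm{Poisson}(\lambda)$ and, for $v\neq r$, $L_v\sim\mathrm{Poisson}(\lambda(1-\alpha_{(\mathrm{pa}(v),v)}))$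 and $I_{v,i}\sim\mathrm{Bernoulli}(\alpha_{(\mathrm{pa}(v),v)})$. For a rooted tree $\mathcal T_r$ define recursively, for $\boldsymbol t=(t_j)_j$, $$\eta_v^{\mathcal T_r}(\boldsymbol t)=t_v\prod_{j\in\mathrm{ch}(v)}\bigl(1-\alpha_{(v,j)}+\alpha_{(v,j)}\,\eta_j^{\mathcal T_r}(\boldsymbol t)\bigr).$$ Write $X\preceq_{st}X'$ if $P(X>x)\le P(X'>x)$ for all $x\in\mathbb R$, and $X\preceq_{cx}X'$ if $\mathrm E[\varphi(X)]\le \mathrm E[\varphi(X')]$ for every convex $\varphi:\mathbb R\to\mathbb R$ for which both expectations exist (i.e. $\varphi(X)$ and $\varphi(X')$ are integrable). **Theorem.** Let $\mathcal T=(\mathcal V,\mathcal E)$ and $\mathcal T'=(\mathcal V,\mathcal E')$ be trees and $u,v,w\in\mathcal V$ with $(u,v)\in\mathcal E$, $(u,w)\in\mathcal E'$ and $\mathcal E\setminus\{(u,v)\}=\mathcal E'\setminus\{(u,w)\}$. Let $\lambda>0$, let $\boldsymbol\alpha\in[0,1]^{\mathcal E}$ and $\boldsymbol\alpha'\in[0,1]^{\mathcal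 E'}$ satisfy $\alpha_e=\alpha'_e$ for every $e\in\mathcal E\setminus\{(u,v)\}$ and $\alpha_{(u,v)}=\alpha'_{(u,w)}$, and let $\boldsymbol N\sim\mathrm{MPMRF}(\lambda,\boldsymbol\alpha,\mathcal T)$ and $\boldsymbol N'\sim\mathrm{MPMRF}(\lambda,\boldsymbol\alpha',\mathcal T')$, with sums $M=\sum_{i\in\mathcal V}N_i$ and $M'=\sum_{i\in\mathcal V}N'_i$. Let $\tau^*$ be the tree obtained from $\mathcal T$ by deleting the vertices $\{u\}\cup\mathrm{dsc}(u)$, descendants being taken in $\mathcal T_v$ (equivalently, from $\mathcal T'$ by deleting $\{u\}\cup\mathrm{dsc}(u)$ with descendants taken in $\mathcal T'_w$), with the edge parameters inherited from $\boldsymbol\alpha$; it contains $v$ and $w$. Let $H_v^{\tau^*_v}$ and $H_w^{\tau^*_w}$ be $\mathbb N$-valued random variables with probability generating functions $$\mathrm E\bigl[t^{H_v^{\tau^*_v}}\bigr]=\eta_v^{\tau^*_v}(t,\dots,t),\qquad \mathrm E\bigl[t^{H_w^{\tau^*_w}}\bigr]=\eta_w^{\tau^*_w}(t,\dots,t),\qquad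 t\in[-1,1].$$ If $H_v^{\tau^*_v}\preceq_{st}H_w^{\tau^*_w}$, then $M\preceq_{cx}M'$. -/

import Mathlib

open MeasureTheory ProbabilityTheory
open scoped NNReal unitInterval

namespace TreeMRF

variable {V : Type*}

/-! ### Rooted trees -/

/-- `dsc(v)` in the tree `T` rooted at `r`: the vertices `j ≠ v` such that `v` is on the path
from `j` to the root. -/
def dsc (T : SimpleGraph V) (r v : V) : Set V :=
  {j | j ≠ v ∧ ∃ p : T.Walk j r, p.IsPath ∧ v ∈ p.support}

/-- `vdsc(v) = {v} ∪ dsc(v)` in the tree `T` rooted at `r`. -/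
def vdsc (T : SimpleGraph V) (r v : V) : Set V :=
  {v} ∪ dsc T r v

/-- `j` is a child of `v` (equivalently `v = pa(j)`) in the tree `T` rooted at `r`: it is a
neighbour of `v` that is one step further away from the root. See `isChild_iff`. -/
def IsChild (T : SimpleGraph V) (r v j : V) : Prop :=
  T.Adj v j ∧ T.dist r j = T.dist r v + 1

/-- In a tree, the children of `v` are the descendants of `v` that are adjacent to `v`. -/
theorem isChild_iff {T : SimpleGraph V} (hT : T.IsTree) (r v j : V) :
    IsChild T r v j ↔ j ∈ dsc T r v ∧ T.Adj v j := by
  classical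
  constructor
  · rintro ⟨hadj, hd⟩
    obtain ⟨p, hp⟩ := hT.connected.exists_walk_length_eq_dist v r
    have hlen : (SimpleGraph.Walk.cons hadj.symm p).length = T.dist j r := by
      rw [SimpleGraph.Walk.length_cons, hp, T.dist_comm (u := v), T.dist_comm (u := j), hd]
    exact ⟨⟨hadj.ne', _, SimpleGraph.Walk.isPath_of_length_eq_dist _ hlen, by simp⟩, hadj⟩
  · rintro ⟨⟨hne, p, hp, hv⟩, hadj⟩
    obtain ⟨q, hq⟩ := hT.connected.exists_walk_length_eq_dist j r
    have hq' := SimpleGraph.Walk.isPath_of_length_eq_dist _ hq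
    have hpq : p = q :=
      congrArg Subtype.val ((hT.isAcyclic.subsingleton_path j r).elim ⟨p, hp⟩ ⟨q, hq'⟩)
    have hle : T.dist r v + 1 ≤ T.dist r j := by
      have h1 : (p.takeUntil v hv).length + (p.dropUntil v hv).length = p.length := by
        rw [← SimpleGraph.Walk.length_append, SimpleGraph.Walk.take_spec]
      have h2 : 1 ≤ (p.takeUntil v hv).length := by
        rcases Nat.eq_zero_or_pos (p.takeUntil v hv).length with h | h
        · exact absurd (SimpleGraph.Walk.eq_of_length_eq_zero h) hne
        · exact h
      have h3 : T.dist v r ≤ (p.dropUntil v hv).length := T.dist_le _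
      have h4 : p.length = T.dist j r := by rw [hpq, hq]
      rw [T.dist_comm (u := r) (v := v), T.dist_comm (u := r) (v := j)]
      omega
    refine ⟨hadj, ?_⟩
    rcases hT.dist_eq_dist_add_one_of_adj r hadj with h | h <;> omega

/-- The distance from the root is less than the number of vertices. -/
theorem dist_lt_card [Fintype V] (T : SimpleGraph V) (r v : V) :
    T.dist r v < Fintype.card V := by
  by_cases h : T.Reachable r v
  · obtain ⟨p, hp, hl⟩ := h.exists_path_of_dist
    rw [← hl]
    exact hp.length_lt
  · rw [SimpleGraph.dist_eq_zero_of_not_reachable h]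
    exact Fintype.card_pos_iff.mpr ⟨r⟩

open Classical in
/-- The children `ch(v)` of `v` in the tree `T` rooted at `r`. -/
noncomputable def ch [Fintype V] (T : SimpleGraph V) (r v : V) : Finset V :=
  Finset.univ.filter (fun j => IsChild T r v j)

/-- The joint generating function `η_v` of the tree `T` rooted at `r` with edge parameters `α`:
`η_v(t) = t_v ∏_{j ∈ ch(v)} (1 - α_{(v,j)} + α_{(v,j)} η_j(t))`. -/
noncomputable def eta [Fintype V] (T : SimpleGraph V) (α : Sym2 V → I) (r v : V) (t : V → ℝ) :
    ℝ :=
  t v * ∏ j ∈ (ch T r v).attach, (1 - (α s(v, j) : ℝ) + (α s(v, j) : ℝ) * eta T α r j t)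
termination_by Fintype.card V - T.dist r v
decreasing_by
  have hj : IsChild T r v j := by
    have h := j.2
    simp only [ch, Finset.mem_filter, Finset.mem_univ, true_and] at h
    exact h
  have h1 := hj.2
  have h2 := dist_lt_card T r (j : V)
  omega

/-- The residual tree `τ*`, obtained from the tree `T` by pruning (deleting) the vertices in
`{u} ∪ dsc(u)`, with descendants taken in `T` rooted at `v`. It is represented as a graph on `V`
in which the deleted vertices are isolated; for a root in `τ*` they are descendants of no
other vertex and do not enter `eta`. -/
def residual (T : SimpleGraph V) (u v : V) : SimpleGraph V :=
  ((⊤ : T.Subgraph).deleteVerts (vdsc T v u)).spanningCoe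

/-! ### The family MPMRF -/

/-- The stochastic representation of a tree-structured Markov random field with Poisson marginal
distributions of parameter `lam` along the tree `T` rooted at `r`. All the variables `L v` and
`B v i` are mutually independent, `L r` is Poisson of parameter `lam`, and for a vertex `v` with
parent `p`, `L v` is Poisson of parameter `lam (1 - α_{(p,v)})`, the `B v i` are Bernoulli of
parameter `α_{(p,v)}`, and `N v = L v + α_{(p,v)} ∘ N p` where the binomial thinning is
`α_{(p,v)} ∘ N p = ∑_{i < N p} B v i`. -/
structure IsRepresentation (lam : ℝ≥0) (α : Sym2 V → I) (T : SimpleGraph V) (r : V)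
    {Ω : Type*} [MeasurableSpace Ω] (P : Measure Ω)
    (L : V → Ω → ℕ) (B : V → ℕ → Ω → ℕ) (N : V → Ω → ℕ) : Prop where
  indep : iIndepFun (Sum.elim L (fun k : V × ℕ => B k.1 k.2)) P
  law_root : HasLaw (L r) (poissonMeasure lam) P
  law_shock : ∀ p v, IsChild T r p v →
    HasLaw (L v) (poissonMeasure (lam * unitInterval.toNNReal (σ (α s(p, v))))) P
  law_thinning : ∀ p v, IsChild T r p v → ∀ i,
    HasLaw (B v i) (bernoulliMeasure 1 0 (α s(p, v))) P
  eq_root : ∀ ω, N r ω = L r ω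
  eq_child : ∀ p v, IsChild T r p v →
    ∀ ω, N v ω = L v ω + ∑ i ∈ Finset.range (N p ω), B v i ω

/-- `N ∼ MPMRF(lam, α, T)`: the joint distribution of `N = (N v, v ∈ V)` is that of a vector
given by the stochastic representation along `T` for some choice of the root. -/
def IsMPMRF (lam : ℝ≥0) (α : Sym2 V → I) (T : SimpleGraph V)
    {Ω : Type*} [MeasurableSpace Ω] (P : Measure Ω) (N : V → Ω → ℕ) : Prop :=
  ∃ (r : V) (Ω₀ : Type) (_ : MeasurableSpace Ω₀) (P₀ : Measure Ω₀)
    (L : V → Ω₀ → ℕ) (B : V → ℕ → Ω₀ → ℕ) (N₀ : V → Ω₀ → ℕ),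
    IsProbabilityMeasure P₀ ∧ IsRepresentation lam α T r P₀ L B N₀ ∧
    IdentDistrib (fun ω v => N v ω) (fun ω v => N₀ v ω) P P₀

/-! ### Generating functions and stochastic orders -/

/-- The probability generating function `t ↦ E[t^H]` of a count random variable `H`. -/
noncomputable def pgf {Ω : Type*} [MeasurableSpace Ω] (H : Ω → ℕ) (P : Measure Ω) (t : ℝ) : ℝ :=
  ∫ ω, t ^ H ω ∂P

/-- The usual stochastic order `X ≤_st X'`: `P(X > x) ≤ P'(X' > x)` for every real `x`. -/
def StochasticOrder {Ω Ω' : Type*} [MeasurableSpace Ω] [MeasurableSpace Ω']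
    (X : Ω → ℝ) (P : Measure Ω) (X' : Ω' → ℝ) (P' : Measure Ω') : Prop :=
  ∀ x : ℝ, P {ω | x < X ω} ≤ P' {ω | x < X' ω}

/-- The convex order `X ≤_cx X'`: `E[φ(X)] ≤ E[φ(X')]` for every convex function `φ` on the
real line for which the expectations exist. -/
def ConvexOrder {Ω Ω' : Type*} [MeasurableSpace Ω] [MeasurableSpace Ω']
    (X : Ω → ℝ) (P : Measure Ω) (X' : Ω' → ℝ) (P' : Measure Ω') : Prop :=
  ∀ φ : ℝ → ℝ, ConvexOn ℝ Set.univ φ →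
    Integrable (fun ω => φ (X ω)) P → Integrable (fun ω => φ (X' ω)) P' →
    ∫ ω, φ (X ω) ∂P ≤ ∫ ω, φ (X' ω) ∂P'

end TreeMRF

/-!
The proof rests on a formula for the joint generating function of `N` that does not mention a root.
Keep each edge `e` of the tree with probability `α e`, independently of the others. Then
`E[∏ t_v ^ N_v] = exp (λ (g(t) - g(1)))`, where `g(t)` is the expected sum, over the clusters `c`
of this percolation, of `∏_{v ∈ c} t_v`. It is proved by integrating out a leaf `l` with parent
`p`: thinning replaces `t_p` by `t_p (1 - α + α t_l)`, and `g` obeys the same recursion because it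
is affine in each `t_v` (`clusterSum_insert_leaf`, `IsRepresentation.integral_leaf`,
`IsMPMRF.integral_prod_pow`). Likewise `eta` at a root is the generating function of the size of
the cluster of that root (`eta_eq_perc`, `eta_residual_eq_perc`).

On the common forest of `T` and `T'`, let `h_z` be the generating function of the size of the
cluster of `z`. An edge between two components merges two independent clusters, so moving the edge
from `(u, v)` to `(u, w)` changes `g`, as a polynomial in one variable, by
`α (h_u - 1) (h_w - h_v)` (`clusterPoly_insert_sub`). Both factors are multiples of `X - 1`. The
cofactor of `h_u - 1` has for coefficients the tail probabilities of the cluster size, and that of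
`h_w - h_v` has the differences of the tail probabilities of `Hw` and `Hv`, which are nonnegative
by the stochastic order (`exists_eq_X_sub_one_mul`). Hence the change of `p = λ g` is `(X - 1)²`
times a polynomial with nonnegative coefficients.

The sum `M` has generating function `exp (p(t) - p(1))`, so
`E[φ(M)] = ∑ₙ e^{-p(1)} / n! · ⟨φ, pⁿ⟩`, where `⟨φ, ·⟩` is the linear functional `Xᵏ ↦ φ(k)`
(`hasSum_integral_of_pgf_eq_exp`). Convexity of `φ` says that `⟨φ, (X - 1)² q⟩ ≥ 0` whenever `q`
has nonnegative coefficients. As `p'ⁿ - pⁿ` is `p' - p` times such a polynomial, the series for `M`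
and `M'` compare term by term. Since `p` is a polynomial, each `⟨φ, pⁿ⟩` is a finite sum, and no
integrability beyond that of `φ(M)` and `φ(M')` is needed.
-/

namespace TreeMRF

section Percolation

open scoped Classical

/-! ### Bernoulli percolation on a finite set of edges -/

section perc

variable {ε R S : Type*} [DecidableEq ε] [CommRing R] [CommRing S]

/-- The expectation of `f ω`, where the random set `ω ⊆ E` contains each `e ∈ E` independently
with probability `a e`. The weights live in an arbitrary commutative ring, so that the same
notion serves for numbers and for polynomials. -/
noncomputable def perc (a : ε → R) (E : Finset ε) (f : Finset ε → R) : R :=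
  ∑ ω ∈ E.powerset, (∏ e ∈ ω, a e) * (∏ e ∈ E \ ω, (1 - a e)) * f ω

lemma perc_empty (a : ε → R) (f : Finset ε → R) : perc a ∅ f = f ∅ := by
  simp [perc]

lemma perc_congr {a : ε → R} {E : Finset ε} {f g : Finset ε → R}
    (h : ∀ ω ⊆ E, f ω = g ω) : perc a E f = perc a E g :=
  Finset.sum_congr rfl fun ω hω => by rw [h ω (Finset.mem_powerset.1 hω)]

/-- Conditioning on the state of the edge `e`. -/
lemma perc_insert (a : ε → R) {E : Finset ε} {e : ε} (he : e ∉ E) (f : Finset ε → R) :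
    perc a (insert e E) f
      = (1 - a e) * perc a E f + a e * perc a E (fun ω => f (insert e ω)) := by
  unfold perc
  rw [Finset.sum_powerset_insert he, Finset.mul_sum, Finset.mul_sum]
  congr 1
  · refine Finset.sum_congr rfl fun ω hω => ?_
    have hω : e ∉ ω := fun h => he (Finset.mem_powerset.1 hω h)
    rw [Finset.insert_sdiff_of_notMem _ hω, Finset.prod_insert (by simp [he])]
    ring
  · refine Finset.sum_congr rfl fun ω hω => ?_
    have hω : e ∉ ω := fun h => he (Finset.mem_powerset.1 hω h)
    rw [Finset.insert_sdiff_insert, Finset.sdiff_insert_of_notMem he, Finset.prod_insert hω]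
    ring

lemma perc_add (a : ε → R) (E : Finset ε) (f g : Finset ε → R) :
    perc a E (fun ω => f ω + g ω) = perc a E f + perc a E g := by
  simp only [perc, mul_add, Finset.sum_add_distrib]

lemma perc_sub (a : ε → R) (E : Finset ε) (f g : Finset ε → R) :
    perc a E (fun ω => f ω - g ω) = perc a E f - perc a E g := by
  simp only [perc, mul_sub, Finset.sum_sub_distrib]

lemma perc_const_mul (a : ε → R) (E : Finset ε) (c : R) (f : Finset ε → R) :
    perc a E (fun ω => c * f ω) = c * perc a E f := by
  simp only [perc, Finset.mul_sum]
  exact Finset.sum_congr rfl fun ω _ => by ring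

lemma perc_const (a : ε → R) (E : Finset ε) (c : R) : perc a E (fun _ => c) = c := by
  induction E using Finset.induction_on with
  | empty => exact perc_empty a _
  | insert e E he ih => rw [perc_insert a he, ih]; ring

lemma map_perc (φ : R →+* S) (a : ε → R) (E : Finset ε) (f : Finset ε → R) :
    φ (perc a E f) = perc (fun e => φ (a e)) E (fun ω => φ (f ω)) := by
  simp [perc, map_sum, map_prod]

/-- Two functions of the open edges such that no edge influences both of them are independent. -/
lemma perc_mul (a : ε → R) (E : Finset ε) (f g : Finset ε → R)
    (h : ∀ e ∈ E, (∀ ω ⊆ E, f (insert e ω) = f ω) ∨ (∀ ω ⊆ E, g (insert e ω) = g ω)) :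
    perc a E (fun ω => f ω * g ω) = perc a E f * perc a E g := by
  induction E using Finset.induction_on generalizing f g with
  | empty => simp [perc_empty]
  | insert e E he ih =>
    have hE : E ⊆ insert e E := Finset.subset_insert _ _
    have hins : ∀ ω ⊆ E, insert e ω ⊆ insert e E := fun ω hω => Finset.insert_subset_insert e hω
    have h0 : perc a E (fun ω => f ω * g ω) = perc a E f * perc a E g :=
      ih f g fun e' he' => (h e' (hE he')).imp (fun H ω hω => H ω (hω.trans hE))
        (fun H ω hω => H ω (hω.trans hE))
    have h1 : perc a E (fun ω => f (insert e ω) * g (insert e ω))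
        = perc a E (fun ω => f (insert e ω)) * perc a E (fun ω => g (insert e ω)) :=
      ih (fun ω => f (insert e ω)) (fun ω => g (insert e ω)) fun e' he' =>
        (h e' (hE he')).imp
          (fun H ω hω => by rw [Finset.insert_comm]; exact H _ (hins ω hω))
          (fun H ω hω => by rw [Finset.insert_comm]; exact H _ (hins ω hω))
    rw [perc_insert a he, perc_insert a he, perc_insert a he, h0, h1]
    rcases h e (Finset.mem_insert_self _ _) with H | H
    · rw [perc_congr (f := fun ω => f (insert e ω)) (g := f) fun ω hω => H ω (hω.trans hE)]
      ring
    · rw [perc_congr (f := fun ω => g (insert e ω)) (g := g) fun ω hω => H ω (hω.trans hE)]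
      ring

end perc

/-! ### Clusters -/

variable {V : Type*}

/-- `x` and `y` are joined by a path of edges of `ω`. -/
def Joined (ω : Finset (Sym2 V)) (x y : V) : Prop :=
  (SimpleGraph.fromEdgeSet (ω : Set (Sym2 V))).Reachable x y

lemma Joined.refl (ω : Finset (Sym2 V)) (x : V) : Joined ω x x := SimpleGraph.Reachable.refl x

lemma Joined.symm {ω : Finset (Sym2 V)} {x y : V} (h : Joined ω x y) : Joined ω y x :=
  SimpleGraph.Reachable.symm h

lemma Joined.trans {ω : Finset (Sym2 V)} {x y z : V} (h : Joined ω x y) (h' : Joined ω y z) :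
    Joined ω x z :=
  SimpleGraph.Reachable.trans h h'

lemma Joined.mono {ω ω' : Finset (Sym2 V)} (hω : ω ⊆ ω') {x y : V} (h : Joined ω x y) :
    Joined ω' x y :=
  SimpleGraph.Reachable.mono (SimpleGraph.fromEdgeSet_mono (by exact_mod_cast hω)) h

lemma joined_of_mem {ω : Finset (Sym2 V)} {x y : V} (h : s(x, y) ∈ ω) : Joined ω x y := by
  by_cases hxy : x = y
  · subst hxy; exact Joined.refl _ _
  · exact SimpleGraph.Adj.reachable (by simpa [hxy] using h)

/-- Induction along a path of edges of `ω`. -/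
lemma Joined.rec_on {ω : Finset (Sym2 V)} {x : V} {Q : V → Prop} {y : V} (h : Joined ω x y)
    (h0 : Q x) (hs : ∀ y z, Joined ω x y → Q y → s(y, z) ∈ ω → Q z) : Q y := by
  rw [Joined, SimpleGraph.reachable_iff_reflTransGen] at h
  induction h with
  | refl => exact h0
  | tail hab hbc ih =>
    refine hs _ _ ?_ ih (by simpa using hbc.1)
    exact (SimpleGraph.reachable_iff_reflTransGen _ _).2 hab

lemma joined_insert {ω : Finset (Sym2 V)} {x y a b : V} :
    Joined (insert s(x, y) ω) a b ↔
      Joined ω a b ∨ (Joined ω a x ∧ Joined ω y b) ∨ (Joined ω a y ∧ Joined ω x b) := by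
  constructor
  · intro h
    refine h.rec_on (Q := fun b => Joined ω a b ∨ (Joined ω a x ∧ Joined ω y b) ∨
      (Joined ω a y ∧ Joined ω x b)) (Or.inl (Joined.refl _ _)) ?_
    intro c d _ hc hcd
    rcases Finset.mem_insert.1 hcd with h | h
    · rcases Sym2.eq_iff.1 h with ⟨rfl, rfl⟩ | ⟨rfl, rfl⟩
      · rcases hc with hc | ⟨h1, h2⟩ | ⟨h1, h2⟩
        · exact Or.inr (Or.inl ⟨hc, Joined.refl _ _⟩)
        · exact Or.inr (Or.inl ⟨h1, Joined.refl _ _⟩)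
        · exact Or.inl h1
      · rcases hc with hc | ⟨h1, h2⟩ | ⟨h1, h2⟩
        · exact Or.inr (Or.inr ⟨hc, Joined.refl _ _⟩)
        · exact Or.inl h1
        · exact Or.inr (Or.inr ⟨h1, Joined.refl _ _⟩)
    · have := joined_of_mem h
      rcases hc with hc | ⟨h1, h2⟩ | ⟨h1, h2⟩
      · exact Or.inl (hc.trans this)
      · exact Or.inr (Or.inl ⟨h1, h2.trans this⟩)
      · exact Or.inr (Or.inr ⟨h1, h2.trans this⟩)
  · have hs : ω ⊆ insert s(x, y) ω := Finset.subset_insert _ _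
    have hxy : Joined (insert s(x, y) ω) x y := joined_of_mem (Finset.mem_insert_self _ _)
    rintro (h | ⟨h1, h2⟩ | ⟨h1, h2⟩)
    · exact h.mono hs
    · exact ((h1.mono hs).trans hxy).trans (h2.mono hs)
    · exact ((h1.mono hs).trans hxy.symm).trans (h2.mono hs)

variable [Fintype V]

/-- The cluster of `x`: the vertices joined to `x` by edges of `ω`. -/
noncomputable def cluster (ω : Finset (Sym2 V)) (x : V) : Finset V :=
  Finset.univ.filter (fun y => Joined ω x y)

lemma mem_cluster {ω : Finset (Sym2 V)} {x y : V} : y ∈ cluster ω x ↔ Joined ω x y := by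
  simp [cluster]

lemma self_mem_cluster (ω : Finset (Sym2 V)) (x : V) : x ∈ cluster ω x :=
  mem_cluster.2 (Joined.refl _ _)

lemma cluster_eq_of_joined {ω : Finset (Sym2 V)} {x y : V} (h : Joined ω x y) :
    cluster ω x = cluster ω y := by
  ext z
  rw [mem_cluster, mem_cluster]
  exact ⟨fun h' => h.symm.trans h', fun h' => h.trans h'⟩

lemma cluster_eq_iff {ω : Finset (Sym2 V)} {x y : V} :
    cluster ω x = cluster ω y ↔ Joined ω x y :=
  ⟨fun h => mem_cluster.1 (h ▸ self_mem_cluster ω y), cluster_eq_of_joined⟩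

lemma disjoint_cluster {ω : Finset (Sym2 V)} {x y : V} (h : ¬ Joined ω x y) :
    Disjoint (cluster ω x) (cluster ω y) := by
  rw [Finset.disjoint_left]
  intro z hx hy
  exact h ((mem_cluster.1 hx).trans (mem_cluster.1 hy).symm)

lemma cluster_insert {ω : Finset (Sym2 V)} {x y : V} :
    cluster (insert s(x, y) ω) x = cluster ω x ∪ cluster ω y := by
  ext z
  simp only [mem_cluster, Finset.mem_union, joined_insert]
  constructor
  · rintro (h | ⟨_, h⟩ | ⟨_, h⟩) <;> simp [h]
  · rintro (h | h)
    · exact Or.inl h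
    · exact Or.inr (Or.inl ⟨Joined.refl _ _, h⟩)

lemma cluster_insert_of_not_joined {ω : Finset (Sym2 V)} {x y z : V} (hx : ¬ Joined ω z x)
    (hy : ¬ Joined ω z y) : cluster (insert s(x, y) ω) z = cluster ω z := by
  ext b
  simp [mem_cluster, joined_insert, hx, hy]

/-- The set of all clusters. -/
noncomputable def clusters (ω : Finset (Sym2 V)) : Finset (Finset V) :=
  Finset.univ.image (cluster ω)

/-- Opening an edge between two different clusters merges them. -/
lemma sum_clusters_insert {R : Type*} [CommRing R] {ω : Finset (Sym2 V)} {x y : V}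
    (h : ¬ Joined ω x y) (f : Finset V → R) :
    ∑ c ∈ clusters (insert s(x, y) ω), f c = ∑ c ∈ clusters ω, f c
      + (f (cluster ω x ∪ cluster ω y) - f (cluster ω x) - f (cluster ω y)) := by
  set D : Finset (Finset V) :=
    ((clusters ω).erase (cluster ω x)).erase (cluster ω y) with hD
  have hne : cluster ω y ≠ cluster ω x := fun h' => h (cluster_eq_iff.1 h'.symm)
  have hx : cluster ω x ∈ clusters ω := Finset.mem_image_of_mem _ (Finset.mem_univ x)
  have hy : cluster ω y ∈ (clusters ω).erase (cluster ω x) :=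
    Finset.mem_erase.2 ⟨hne, Finset.mem_image_of_mem _ (Finset.mem_univ y)⟩
  have hnot : cluster ω x ∪ cluster ω y ∉ D := by
    intro hmem
    simp only [hD, clusters, Finset.mem_erase, Finset.mem_image, Finset.mem_univ, true_and] at hmem
    obtain ⟨_, hnx, z, hz⟩ := hmem
    have : x ∈ cluster ω z := by
      rw [hz]; exact Finset.mem_union_left _ (self_mem_cluster ω x)
    exact hnx (hz ▸ cluster_eq_of_joined (mem_cluster.1 this))
  have hins : clusters (insert s(x, y) ω) = insert (cluster ω x ∪ cluster ω y) D := by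
    ext c
    simp only [hD, clusters, Finset.mem_insert, Finset.mem_erase, Finset.mem_image,
      Finset.mem_univ, true_and]
    constructor
    · rintro ⟨z, rfl⟩
      by_cases hz : Joined ω z x ∨ Joined ω z y
      · left
        rw [← cluster_insert]
        refine cluster_eq_of_joined ?_
        rw [joined_insert]
        rcases hz with hz | hz
        · exact Or.inl hz
        · exact Or.inr (Or.inr ⟨hz, Joined.refl _ _⟩)
      · rw [not_or] at hz
        right
        rw [cluster_insert_of_not_joined hz.1 hz.2]
        exact ⟨fun h => hz.2 (cluster_eq_iff.1 h), fun h => hz.1 (cluster_eq_iff.1 h), z, rfl⟩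
    · rintro (rfl | ⟨h1, h2, z, rfl⟩)
      · exact ⟨x, cluster_insert⟩
      · refine ⟨z, cluster_insert_of_not_joined (fun h => h2 (cluster_eq_of_joined h))
          (fun h => h1 (cluster_eq_of_joined h))⟩
  rw [hins, Finset.sum_insert hnot, ← Finset.add_sum_erase _ f hx, ← Finset.add_sum_erase _ f hy]
  ring

/-- The expected sum of `f` over the clusters. -/
noncomputable def clusterSum {R : Type*} [CommRing R] (a : Sym2 V → R) (f : Finset V → R)
    (E : Finset (Sym2 V)) : R :=
  perc a E (fun ω => ∑ c ∈ clusters ω, f c)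

lemma clusterSum_insert {R : Type*} [CommRing R] (a : Sym2 V → R) (f : Finset V → R)
    {E : Finset (Sym2 V)} {x y : V} (h : ¬ Joined E x y) :
    clusterSum a f (insert s(x, y) E) = clusterSum a f E + a s(x, y) *
      perc a E (fun ω => f (cluster ω x ∪ cluster ω y) - f (cluster ω x) - f (cluster ω y)) := by
  have he : s(x, y) ∉ E := fun h' => h (joined_of_mem h')
  unfold clusterSum
  rw [perc_insert a he, perc_congr (f := fun ω => ∑ c ∈ clusters (insert s(x, y) ω), f c)
    fun ω hω => sum_clusters_insert (fun h' => h (h'.mono hω)) f, perc_add]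
  ring

/-- The clusters of two vertices that are not joined in `E` are independent. -/
lemma perc_mul_cluster {R : Type*} [CommRing R] (a : Sym2 V → R) (f g : Finset V → R)
    {E : Finset (Sym2 V)} {x y : V} (h : ¬ Joined E x y) :
    perc a E (fun ω => f (cluster ω x) * g (cluster ω y))
      = perc a E (fun ω => f (cluster ω x)) * perc a E (fun ω => g (cluster ω y)) := by
  have key : ∀ z e, e ∈ E → (∀ b ∈ e, ¬ Joined E z b) → ∀ ω ⊆ E,
      cluster (insert e ω) z = cluster ω z := by
    intro z e he hz ω hω
    induction e with
    | h b c =>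
      exact cluster_insert_of_not_joined (fun h => hz b (by simp) (h.mono hω))
        (fun h => hz c (by simp) (h.mono hω))
  refine perc_mul a E _ _ fun e he => ?_
  by_cases hx : ∀ b ∈ e, ¬ Joined E x b
  · exact Or.inl fun ω hω => by rw [key x e he hx ω hω]
  · right
    have hy : ∀ b ∈ e, ¬ Joined E y b := by
      push Not at hx
      obtain ⟨b, hb, hxb⟩ := hx
      intro c hc hyc
      obtain ⟨d, rfl⟩ := Sym2.mem_iff_exists.1 hb
      have hbc : Joined E b c := by
        rcases Sym2.mem_iff.1 hc with rfl | rfl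
        · exact Joined.refl _ _
        · exact joined_of_mem he
      exact h ((hxb.trans hbc).trans hyc.symm)
    exact fun ω hω => by rw [key y e he hy ω hω]

end Percolation

section Trees

open scoped Classical

variable {V : Type*}

/-! ### Parents in a rooted tree -/

lemma isChild_parent_unique {G : SimpleGraph V} (hG : G.IsAcyclic) {r x y k : V}
    (hx : IsChild G r x k) (hy : IsChild G r y k) : x = y := by
  have hk : G.Reachable r k := by
    by_contra h
    have h1 := SimpleGraph.dist_eq_zero_of_not_reachable h
    have h2 := hx.2
    omega
  obtain ⟨p, _, hp⟩ := (hk.trans hx.1.symm.reachable).exists_path_of_dist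
  obtain ⟨q, _, hq⟩ := (hk.trans hy.1.symm.reachable).exists_path_of_dist
  have h1 : (p.concat hx.1).IsPath := SimpleGraph.Walk.isPath_of_length_eq_dist _ (by
    rw [SimpleGraph.Walk.length_concat, hp, hx.2])
  have h2 : (q.concat hy.1).IsPath := SimpleGraph.Walk.isPath_of_length_eq_dist _ (by
    rw [SimpleGraph.Walk.length_concat, hq, hy.2])
  have h3 : p.concat hx.1 = q.concat hy.1 :=
    congrArg Subtype.val ((hG.subsingleton_path r k).elim ⟨_, h1⟩ ⟨_, h2⟩)
  rw [← SimpleGraph.Walk.penultimate_concat p hx.1, h3, SimpleGraph.Walk.penultimate_concat]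

lemma IsChild.not_isChild {G : SimpleGraph V} {r x y : V} (h : IsChild G r x y) :
    ¬ IsChild G r y x := fun h' => by
  have h1 := h.2
  have h2 := h'.2
  omega

lemma not_isChild_root {G : SimpleGraph V} {r x : V} : ¬ IsChild G r x r := fun h => by
  have := h.2
  rw [SimpleGraph.dist_self] at this
  omega

lemma adj_iff_isChild {G : SimpleGraph V} (hG : G.IsAcyclic) {r k x : V}
    (hk : G.Reachable r k) : G.Adj k x ↔ IsChild G r k x ∨ IsChild G r x k := by
  constructor
  · intro h
    rcases hG.dist_eq_dist_add_one_of_adj_of_reachable r h hk with h' | h'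
    · exact Or.inr ⟨h.symm, h'⟩
    · exact Or.inl ⟨h, h'⟩
  · rintro (h | h)
    · exact h.1
    · exact h.1.symm

/-! ### Forests -/

/-- A finite set of edges without cycles: every edge is a bridge. -/
def Forest (E : Finset (Sym2 V)) : Prop :=
  ∀ x y, s(x, y) ∈ E → ¬ Joined (E.erase s(x, y)) x y

lemma Forest.mono {E E' : Finset (Sym2 V)} (hE : Forest E) (h : E' ⊆ E) : Forest E' :=
  fun x y hxy hj => hE x y (h hxy) (hj.mono (Finset.erase_subset_erase _ h))

variable [Fintype V]

lemma joined_edgeFinset {G : SimpleGraph V} {x y : V} :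
    Joined G.edgeFinset x y ↔ G.Reachable x y := by
  rw [Joined, SimpleGraph.coe_edgeFinset, SimpleGraph.fromEdgeSet_edgeSet]

lemma forest_edgeFinset {G : SimpleGraph V} (hG : G.IsAcyclic) : Forest G.edgeFinset := by
  intro x y hxy
  have h := SimpleGraph.isAcyclic_iff_forall_isBridge.1 hG (SimpleGraph.mem_edgeFinset.1 hxy)
  rw [SimpleGraph.isBridge_iff] at h
  convert h using 2
  rw [Joined]
  have : SimpleGraph.fromEdgeSet ((G.edgeFinset.erase s(x, y) : Finset _) : Set (Sym2 V))
      = G.deleteEdges {s(x, y)} := by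
    ext a b
    simp only [SimpleGraph.fromEdgeSet_adj, Finset.mem_coe, Finset.mem_erase,
      SimpleGraph.mem_edgeFinset, SimpleGraph.mem_edgeSet, SimpleGraph.deleteEdges_adj,
      Set.mem_singleton_iff]
    exact ⟨fun h => ⟨h.1.2, h.1.1⟩, fun h => ⟨⟨h.2, h.1⟩, h.1.ne⟩⟩
  rw [this]

/-! ### The generating function of a rooted tree as a cluster expectation -/

/-- Adding the edge from `x` to `y`, where `y` lies in another component, contributes to the
generating function of the cluster of `x` the factor that `eta` has for a child `y` of `x`. -/
lemma perc_cluster_insert {R : Type*} [CommRing R] (a : Sym2 V → R) (t : V → R)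
    {E : Finset (Sym2 V)} {x y : V} (h : ¬ Joined E x y) :
    perc a (insert s(x, y) E) (fun ω => ∏ v ∈ cluster ω x, t v)
      = perc a E (fun ω => ∏ v ∈ cluster ω x, t v)
        * (1 - a s(x, y) + a s(x, y) * perc a E (fun ω => ∏ v ∈ cluster ω y, t v)) := by
  have he : s(x, y) ∉ E := fun h' => h (joined_of_mem h')
  rw [perc_insert a he,
    perc_congr (f := fun ω => ∏ v ∈ cluster (insert s(x, y) ω) x, t v)
      (g := fun ω => (∏ v ∈ cluster ω x, t v) * ∏ v ∈ cluster ω y, t v) fun ω hω => by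
        rw [cluster_insert, Finset.prod_union (disjoint_cluster fun h' => h (h'.mono hω))],
    perc_mul_cluster a (fun c => ∏ v ∈ c, t v) (fun c => ∏ v ∈ c, t v) h]
  ring

/-- Seen from the vertex `j`, the edge set `E` looks like the part of the graph `G` rooted at `r`
that hangs below `j`: the edges of `E` at a vertex `k` in the component of `j` are the edges of
`G` at `k`, except for the edge from `j` to its parent. -/
def LooksLikeBranch (G : SimpleGraph V) (r : V) (E : Finset (Sym2 V)) (j : V) : Prop :=
  ∀ k, Joined E j k → ∀ x, s(k, x) ∈ E ↔ IsChild G r k x ∨ (IsChild G r x k ∧ k ≠ j)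

lemma mem_ch {G : SimpleGraph V} {r j c : V} : c ∈ ch G r j ↔ IsChild G r j c := by
  simp [ch]

/-- The recursion defining `eta` is solved by the generating function of the cluster of `j` under
percolation: the clusters of the children, once the edges to `j` are removed, are independent. -/
theorem eta_eq_perc {G : SimpleGraph V} (hG : G.IsAcyclic) (α : Sym2 V → I) (r : V) (t : V → ℝ)
    (j : V) (E : Finset (Sym2 V)) (hE : Forest E) (hb : LooksLikeBranch G r E j) :
    eta G α r j t
      = perc (fun e => (α e : ℝ)) E (fun ω => ∏ v ∈ cluster ω j, t v) := by
  induction hn : Fintype.card V - G.dist r j using Nat.strong_induction_on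
    generalizing j E with
  | _ n ih =>
    have hj : ∀ x, s(j, x) ∈ E ↔ IsChild G r j x := fun x => by
      simpa using hb j (Joined.refl _ _) x
    -- the edges that remain when only the children in `A` are kept
    let EA : Finset V → Finset (Sym2 V) := fun A =>
      E \ ((ch G r j) \ A).image (fun c => s(j, c))
    have hmem : ∀ A e, e ∈ EA A ↔ e ∈ E ∧ ∀ c, IsChild G r j c → c ∉ A → s(j, c) ≠ e := by
      intro A e
      simp only [EA, Finset.mem_sdiff, Finset.mem_image, mem_ch, not_exists, not_and]
      exact and_congr_right fun _ => ⟨fun h c hc hA => h c ⟨hc, hA⟩, fun h c hc => h c hc.1 hc.2⟩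
    have main : ∀ A ⊆ ch G r j,
        perc (fun e => (α e : ℝ)) (EA A) (fun ω => ∏ v ∈ cluster ω j, t v)
          = t j * ∏ c ∈ A, (1 - (α s(j, c) : ℝ) + (α s(j, c) : ℝ) * eta G α r c t) := by
      intro A
      induction A using Finset.induction_on with
      | empty =>
        intro _
        have hiso : ∀ ω ⊆ EA ∅, cluster ω j = {j} := by
          intro ω hω
          ext k
          rw [mem_cluster, Finset.mem_singleton]
          constructor
          · intro h
            refine h.rec_on (Q := fun k => k = j) rfl ?_
            rintro y z _ rfl hyz
            have h1 := (hmem ∅ _).1 (hω hyz)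
            exact absurd rfl (h1.2 z ((hj z).1 h1.1) (by simp))
          · rintro rfl
            exact Joined.refl _ _
        rw [perc_congr (g := fun _ => t j) fun ω hω => by rw [hiso ω hω, Finset.prod_singleton],
          perc_const]
        simp
      | insert c A hc ihA =>
        intro hA
        have hcc : IsChild G r j c := mem_ch.1 (hA (Finset.mem_insert_self _ _))
        have hcE : s(j, c) ∈ E := (hj c).2 hcc
        have hcA : s(j, c) ∉ EA A := fun h => ((hmem _ _).1 h).2 c hcc hc rfl
        have hsub : EA A ⊆ E := Finset.sdiff_subset
        have hEins : EA (insert c A) = insert s(j, c) (EA A) := by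
          ext e
          rw [Finset.mem_insert, hmem, hmem]
          constructor
          · rintro ⟨h1, h2⟩
            by_cases he : e = s(j, c)
            · exact Or.inl he
            · refine Or.inr ⟨h1, fun c' h3 h4 h5 => ?_⟩
              by_cases h6 : c' = c
              · exact he (by rw [← h5, h6])
              · exact h2 c' h3 (by simp [h6, h4]) h5
          · rintro (rfl | ⟨h1, h2⟩)
            · refine ⟨hcE, fun c' _ h4 h5 => h4 ?_⟩
              rw [Sym2.congr_right] at h5
              simp [h5]
            · exact ⟨h1, fun c' h3 h4 => h2 c' h3 fun h => h4 (Finset.mem_insert_of_mem h)⟩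
        have hnj : ¬ Joined (EA A) j c := fun h => hE j c hcE (h.mono fun e he =>
          Finset.mem_erase.2 ⟨ne_of_mem_of_not_mem he hcA, hsub he⟩)
        have hbc : LooksLikeBranch G r (EA A) c := by
          intro k hk x
          have hkj : k ≠ j := by rintro rfl; exact hnj hk.symm
          have hjk : Joined E j k := (joined_of_mem hcE).trans (hk.mono hsub)
          have hkE : s(k, x) ∈ E ↔ IsChild G r k x ∨ IsChild G r x k := by
            simpa [hkj] using hb k hjk x
          -- another child of `j` in the component of `c` would close a cycle
          have hsib : IsChild G r j k → k = c := by
            intro hjk'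
            by_contra hne
            by_cases hkA : s(j, k) ∈ EA A
            · exact hnj ((joined_of_mem hkA).trans hk.symm)
            · refine hE j k ((hj k).2 hjk') (Joined.trans (y := c) (joined_of_mem ?_) (hk.mono ?_))
              · refine Finset.mem_erase.2 ⟨fun h => hne ?_, hcE⟩
                rw [Sym2.congr_right] at h
                exact h.symm
              · exact fun e he => Finset.mem_erase.2 ⟨ne_of_mem_of_not_mem he hkA, hsub he⟩
          have hkEA : s(k, x) ∈ EA A ↔ s(k, x) ∈ E ∧ ¬ (x = j ∧ k = c) := by
            constructor
            · intro h
              refine ⟨hsub h, ?_⟩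
              rintro ⟨rfl, rfl⟩
              exact hnj (joined_of_mem h).symm
            · rintro ⟨h1, h2⟩
              refine (hmem _ _).2 ⟨h1, fun c' h3 _ h5 => ?_⟩
              rcases Sym2.eq_iff.1 h5 with ⟨h6, _⟩ | ⟨h6, h7⟩
              · exact hkj h6.symm
              · subst h6 h7
                exact h2 ⟨rfl, hsib h3⟩
          rw [hkEA, hkE]
          constructor
          · rintro ⟨h1 | h1, h2⟩
            · exact Or.inl h1
            · refine Or.inr ⟨h1, ?_⟩
              rintro rfl
              exact h2 ⟨isChild_parent_unique hG h1 hcc, rfl⟩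
          · rintro (h1 | ⟨h1, h2⟩)
            · refine ⟨Or.inl h1, ?_⟩
              rintro ⟨rfl, rfl⟩
              exact hcc.not_isChild h1
            · exact ⟨Or.inr h1, fun h => h2 h.2⟩
        have hlt : Fintype.card V - G.dist r c < n := by
          have h1 := hcc.2
          have h2 := dist_lt_card G r c
          omega
        rw [hEins, perc_cluster_insert _ t hnj,
          ihA fun x hx => hA (Finset.mem_insert_of_mem hx), Finset.prod_insert hc,
          ih _ hlt c (EA A) (hE.mono hsub) hbc rfl]
        ring
    have hfull : EA (ch G r j) = E := by simp [EA]
    have h := main _ (Finset.Subset.refl _)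
    rw [hfull] at h
    rw [h, eta, Finset.prod_attach (ch G r j)
      (fun c => 1 - (α s(j, c) : ℝ) + (α s(j, c) : ℝ) * eta G α r c t)]

/-! ### The residual tree -/

/-- The vertices deleted from `T` to obtain the residual tree are those separated from `v` by the
removal of the edge `(u, v)`. -/
lemma mem_vdsc_iff {T : SimpleGraph V} (hT : T.IsTree) {u v : V} (huv : T.Adj u v) (x : V) :
    x ∈ vdsc T v u ↔ ¬ Joined (T.edgeFinset.erase s(u, v)) v x := by
  have hbr : ¬ Joined (T.edgeFinset.erase s(u, v)) u v :=
    forest_edgeFinset hT.isAcyclic u v (by simpa using huv)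
  constructor
  · rintro (rfl | ⟨_, p, hp, hup⟩) hj
    · exact hbr hj.symm
    · obtain ⟨q, hq⟩ := hj.symm.exists_isPath
      have hle : SimpleGraph.fromEdgeSet ((T.edgeFinset.erase s(u, v) : Finset _) : Set (Sym2 V))
          ≤ T := by
        intro a b hab
        simpa using (Finset.mem_erase.1 (Finset.mem_coe.1 hab.1)).2
      have hpq : p = q.mapLe hle := congrArg Subtype.val
        ((hT.isAcyclic.subsingleton_path x v).elim ⟨p, hp⟩ ⟨_, hq.mapLe hle⟩)
      have huq : u ∈ q.support := by
        rw [hpq] at hup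
        simpa using hup
      exact hbr ⟨q.dropUntil u huq⟩
  · intro hj
    by_contra hx
    apply hj
    have hxu : x ≠ u := fun h => hx (Or.inl h)
    obtain ⟨p, hp⟩ := (hT.connected.preconnected x v).exists_isPath
    have hup : u ∉ p.support := fun h => hx (Or.inr ⟨hxu, p, hp, h⟩)
    refine Joined.symm ⟨p.transfer _ fun e he => ?_⟩
    have heT := p.edges_subset_edgeSet he
    rw [SimpleGraph.edgeSet_fromEdgeSet]
    refine ⟨?_, T.not_isDiag_of_mem_edgeSet heT⟩
    refine Finset.mem_coe.2 (Finset.mem_erase.2 ⟨?_, by simpa using heT⟩)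
    rintro rfl
    exact hup (p.fst_mem_support_of_mem_edges he)

/-- For a root in the residual tree, `eta` is the generating function of the cluster of the root
in the forest obtained from `T` by removing the edge `(u, v)`. -/
theorem eta_residual_eq_perc {T : SimpleGraph V} (hT : T.IsTree) {u v : V} (huv : T.Adj u v)
    (α : Sym2 V → I) (t : V → ℝ) {z : V} (hz : Joined (T.edgeFinset.erase s(u, v)) v z) :
    eta (residual T u v) α z z t = perc (fun e => (α e : ℝ)) (T.edgeFinset.erase s(u, v))
      (fun ω => ∏ x ∈ cluster ω z, t x) := by
  set E₀ := T.edgeFinset.erase s(u, v) with hE₀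
  have hle : residual T u v ≤ T := SimpleGraph.Subgraph.spanningCoe_le _
  have hac : (residual T u v).IsAcyclic := hT.isAcyclic.anti hle
  have hadj : ∀ a b, (residual T u v).Adj a b ↔
      T.Adj a b ∧ Joined E₀ v a ∧ Joined E₀ v b := by
    intro a b
    rw [residual, SimpleGraph.Subgraph.spanningCoe_adj, SimpleGraph.Subgraph.deleteVerts_adj,
      mem_vdsc_iff hT huv, mem_vdsc_iff hT huv]
    simp only [SimpleGraph.Subgraph.verts_top, Set.mem_univ, true_and, not_not,
      SimpleGraph.Subgraph.top_adj]
    tauto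
  have hbr : ¬ Joined E₀ v u := fun h =>
    forest_edgeFinset hT.isAcyclic u v (by simpa using huv) h.symm
  have hedge : ∀ k, Joined E₀ v k → ∀ x, s(k, x) ∈ E₀ ↔ (residual T u v).Adj k x := by
    intro k hk x
    rw [hadj]
    constructor
    · intro h
      exact ⟨by simpa using (Finset.mem_erase.1 h).2, hk, hk.trans (joined_of_mem h)⟩
    · rintro ⟨h1, _, h2⟩
      refine Finset.mem_erase.2 ⟨fun h => ?_, by simpa using h1⟩
      rcases Sym2.eq_iff.1 h with ⟨rfl, _⟩ | ⟨_, rfl⟩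
      · exact hbr hk
      · exact hbr h2
  refine eta_eq_perc hac α z t z E₀
    ((forest_edgeFinset hT.isAcyclic).mono (Finset.erase_subset _ _)) fun k hk x => ?_
  have hreach : (residual T u v).Reachable z k := by
    refine hk.rec_on (Q := fun k => (residual T u v).Reachable z k)
      (SimpleGraph.Reachable.refl z) fun a b ha h hab => ?_
    exact h.trans ((hedge a (hz.trans ha) b).1 hab).reachable
  rw [hedge k (hz.trans hk), adj_iff_isChild hac hreach]
  refine or_congr_right ⟨fun h => ⟨h, ?_⟩, fun h => h.1⟩
  rintro rfl
  exact not_isChild_root h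

end Trees

section Law

open scoped Classical

/-! ### Generating functions of cluster sums -/

section clusterSum

variable {V : Type*} {R : Type*} [CommRing R]

lemma prod_update_mul (t : V → R) (x : V) (b : R) (c : Finset V) :
    ∏ v ∈ c, Function.update t x (t x * b) v = if x ∈ c then (∏ v ∈ c, t v) * b
      else ∏ v ∈ c, t v := by
  split_ifs with hx
  · rw [Finset.prod_update_of_mem hx, ← Finset.mul_prod_erase c t hx, ← Finset.erase_eq]
    ring
  · rw [Finset.prod_update_of_notMem hx]

variable [Fintype V]

/-- The cluster sum is affine in each of the vertex weights. -/
lemma clusterSum_update (a : Sym2 V → R) (t : V → R) (E : Finset (Sym2 V)) (x : V) (b : R) :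
    clusterSum a (fun c => ∏ v ∈ c, Function.update t x (t x * b) v) E
      = clusterSum a (fun c => ∏ v ∈ c, t v) E
        + (b - 1) * perc a E (fun ω => ∏ v ∈ cluster ω x, t v) := by
  unfold clusterSum
  rw [← perc_const_mul, ← perc_add]
  refine perc_congr fun ω _ => ?_
  have hx : cluster ω x ∈ clusters ω := Finset.mem_image_of_mem _ (Finset.mem_univ x)
  rw [← Finset.add_sum_erase _ _ hx, ← Finset.add_sum_erase _ (fun c => ∏ v ∈ c, t v) hx,
    prod_update_mul, if_pos (self_mem_cluster ω x)]
  have hrest : ∀ c ∈ (clusters ω).erase (cluster ω x),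
      ∏ v ∈ c, Function.update t x (t x * b) v = ∏ v ∈ c, t v := by
    intro c hc
    obtain ⟨hne, hc⟩ := Finset.mem_erase.1 hc
    obtain ⟨z, _, rfl⟩ := Finset.mem_image.1 hc
    rw [prod_update_mul, if_neg]
    exact fun h => hne (cluster_eq_of_joined (mem_cluster.1 h))
  rw [Finset.sum_congr rfl hrest]
  ring

lemma cluster_eq_singleton {E : Finset (Sym2 V)} {l : V} (hl : ∀ x, s(l, x) ∉ E) :
    ∀ ω ⊆ E, cluster ω l = {l} := by
  intro ω hω
  ext k
  rw [mem_cluster, Finset.mem_singleton]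
  constructor
  · intro h
    refine h.rec_on (Q := fun k => k = l) rfl ?_
    rintro y z _ rfl hyz
    exact absurd (hω hyz) (hl z)
  · rintro rfl
    exact Joined.refl _ _

/-- Attaching a leaf `l` of weight `s` to the vertex `p` has the same effect on the cluster sum as
multiplying the weight of `p` by `1 - α + α s`, up to an additive term that does not involve
the rest of the tree. -/
lemma clusterSum_insert_leaf (a : Sym2 V → R) (t : V → R) {E : Finset (Sym2 V)} {p l : V}
    (hpl : p ≠ l) (hl : ∀ x, s(l, x) ∉ E) (ht : t l = 1) (s : R) :
    clusterSum a (fun c => ∏ v ∈ c, Function.update t l s v) (insert s(p, l) E)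
      = clusterSum a (fun c => ∏ v ∈ c,
          Function.update t p (t p * (1 - a s(p, l) + a s(p, l) * s)) v) E
        + ((1 - a s(p, l)) * s - 1) := by
  have hsing := cluster_eq_singleton hl
  have hE : ∀ ω ⊆ E, ¬ Joined ω p l := by
    intro ω hω h
    have := mem_cluster.2 h.symm
    rw [hsing ω hω, Finset.mem_singleton] at this
    exact hpl this
  have hs : s = t l * s := by rw [ht, one_mul]
  have h1 : perc a E (fun ω => ∏ v ∈ cluster ω l, t v) = 1 := by
    rw [perc_congr (g := fun _ => 1) fun ω hω => by
      rw [hsing ω hω, Finset.prod_singleton, ht], perc_const]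
  have h2 : perc a E (fun ω =>
        ∏ v ∈ cluster ω p ∪ cluster ω l, Function.update t l (t l * s) v
          - ∏ v ∈ cluster ω p, Function.update t l (t l * s) v
          - ∏ v ∈ cluster ω l, Function.update t l (t l * s) v)
      = (s - 1) * perc a E (fun ω => ∏ v ∈ cluster ω p, t v) - s := by
    rw [← perc_const_mul, ← perc_const a E s, ← perc_sub]
    refine perc_congr fun ω hω => ?_
    have hnot : l ∉ cluster ω p := fun h => hE ω hω (mem_cluster.1 h)
    rw [Finset.prod_union (disjoint_cluster (hE ω hω)), prod_update_mul, if_neg hnot,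
      prod_update_mul, if_pos (self_mem_cluster ω l), hsing ω hω, Finset.prod_singleton, ht,
      perc_const]
    ring
  rw [hs, clusterSum_insert a _ (hE E subset_rfl), clusterSum_update, clusterSum_update, h1, h2,
    ← hs]
  ring

end clusterSum

/-! ### Generating functions of the thinning recursion -/

lemma abs_prod_pow_le_one {ι : Type*} (s : Finset ι) {t : ι → ℝ} (ht : ∀ v, |t v| ≤ 1)
    (n : ι → ℕ) : |∏ v ∈ s, t v ^ n v| ≤ 1 := by
  rw [Finset.abs_prod]
  refine Finset.prod_le_one (fun _ _ => abs_nonneg _) fun v _ => ?_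
  rw [abs_pow]
  exact pow_le_one₀ (abs_nonneg _) (ht v)

lemma integral_pow_poissonMeasure (r : ℝ≥0) (t : ℝ) :
    ∫ n, t ^ n ∂(poissonMeasure r) = Real.exp (r * (t - 1)) := by
  rw [integral_poissonMeasure]
  have h : ∀ n : ℕ, (Real.exp (-r) * (r : ℝ) ^ n / (n.factorial : ℝ)) • t ^ n
      = Real.exp (-r) * ((r * t) ^ n / (n.factorial : ℝ)) := by
    intro n
    rw [smul_eq_mul, mul_pow]
    ring
  simp_rw [h]
  rw [tsum_mul_left, ← congrFun (NormedSpace.exp_eq_tsum_div (𝔸 := ℝ)) (r * t),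
    ← Real.exp_eq_exp_ℝ, ← Real.exp_add]
  congr 1
  ring

lemma abs_thinning_le_one (a : I) {t : ℝ} (ht : |t| ≤ 1) : |1 - (a : ℝ) + a * t| ≤ 1 := by
  have h0 := a.2.1
  have h1 := a.2.2
  rw [abs_le] at ht ⊢
  constructor <;> nlinarith

variable {V : Type*}

lemma measurable_sum_range {Ω : Type*} {m : MeasurableSpace Ω} {f : Ω → ℕ} (hf : Measurable f)
    {g : ℕ → Ω → ℕ} (hg : ∀ i, Measurable (g i)) :
    Measurable (fun ω => ∑ i ∈ Finset.range (f ω), g i ω) := by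
  have h : Measurable (fun q : ℕ × Ω => ∑ i ∈ Finset.range q.1, g i q.2) :=
    measurable_from_prod_countable_right fun n =>
      Finset.measurable_fun_sum (Finset.range n) fun i _ => hg i
  exact h.comp (hf.prodMk measurable_id)

/-! ### Measurability and independence in a representation -/

section Innovations

variable {Ω : Type*} {L : V → Ω → ℕ} {B : V → ℕ → Ω → ℕ}

/-- The σ-algebra generated by the innovations attached to the vertices in `S`. -/
@[reducible]
def innovations (L : V → Ω → ℕ) (B : V → ℕ → Ω → ℕ) (S : Set V) : MeasurableSpace Ω :=
  ⨆ k ∈ {k : V ⊕ V × ℕ | Sum.elim id Prod.fst k ∈ S},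
    MeasurableSpace.comap (Sum.elim L (fun k : V × ℕ => B k.1 k.2) k) inferInstance

lemma measurable_innovations_left {S : Set V} {v : V} (hv : v ∈ S) :
    Measurable[innovations L B S] (L v) := by
  refine Measurable.mono (comap_measurable (L v)) ?_ le_rfl
  exact le_iSup₂_of_le (Sum.inl v) hv le_rfl

lemma measurable_innovations_right {S : Set V} {v : V} (hv : v ∈ S) (i : ℕ) :
    Measurable[innovations L B S] (B v i) := by
  refine Measurable.mono (comap_measurable (B v i)) ?_ le_rfl
  exact le_iSup₂_of_le (Sum.inr (v, i)) hv le_rfl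

end Innovations

section Representation

variable {lam : ℝ≥0} {α : Sym2 V → I} {T : SimpleGraph V} {r : V}
  {Ω : Type*} [MeasurableSpace Ω] {P : Measure Ω}
  {L : V → Ω → ℕ} {B : V → ℕ → Ω → ℕ} {N : V → Ω → ℕ}

lemma exists_parent (hT : T.IsTree) {v : V} (hv : v ≠ r) : ∃ p, IsChild T r p v := by
  obtain ⟨p, hp⟩ := hT.connected.exists_walk_length_eq_dist r v
  have hlen : p.length ≠ 0 := fun h => hv (SimpleGraph.Walk.eq_of_length_eq_zero h).symm
  have hnil : ¬ p.Nil := fun h => hlen (SimpleGraph.Walk.length_eq_zero_iff.2 h)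
  have hadj := p.adj_penultimate hnil
  refine ⟨p.penultimate, hadj, ?_⟩
  have h1 : T.dist r p.penultimate ≤ p.dropLast.length := T.dist_le _
  have h2 : p.dropLast.length + 1 = p.length := SimpleGraph.Walk.length_dropLast_add_one hnil
  rcases hT.dist_eq_dist_add_one_of_adj r hadj with h | h <;> omega

/-- The generating function of the count at a vertex given that its parent has count `k`. -/
lemma IsRepresentation.integral_pow_child [IsProbabilityMeasure P]
    (h : IsRepresentation lam α T r P L B N) (hL : ∀ v, Measurable (L v))
    (hB : ∀ v i, Measurable (B v i)) {p l : V} (hp : IsChild T r p l) (s : ℝ) (k : ℕ) :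
    ∫ ω, s ^ (L l ω + ∑ i ∈ Finset.range k, B l i ω) ∂P
      = Real.exp (lam * ((1 - α s(p, l)) * s - (1 - α s(p, l))))
        * (1 - (α s(p, l) : ℝ) + α s(p, l) * s) ^ k := by
  let g : Option (Fin k) → V ⊕ V × ℕ := fun o => o.elim (Sum.inl l) (fun i => Sum.inr (l, i))
  have hg : Function.Injective g := by
    intro a b hab
    rcases a with _ | a <;> rcases b with _ | b <;> simp_all [g, Fin.ext_iff]
  have hind := h.indep.precomp hg
  have hX : ∀ o, Measurable (Sum.elim L (fun k : V × ℕ => B k.1 k.2) (g o)) := by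
    intro o
    rcases o with _ | i
    · exact hL l
    · exact hB l i
  have key := hind.integral_fun_prod_comp (f := fun _ n => s ^ n)
    (fun o => (hX o).aemeasurable) (fun o => (measurable_of_countable _).aestronglyMeasurable)
  simp only [Fintype.prod_option] at key
  have h1 : ∫ ω, s ^ L l ω ∂P = Real.exp (lam * ((1 - α s(p, l)) * s - (1 - α s(p, l)))) := by
    have := (h.law_shock p l hp).integral_comp (f := fun n => s ^ n)
      (measurable_of_countable _).aestronglyMeasurable
    rw [integral_pow_poissonMeasure] at this
    rw [show (fun ω => s ^ L l ω) = (fun n => s ^ n) ∘ L l from rfl, this]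
    congr 1
    simp
    ring
  have h2 : ∀ i, ∫ ω, s ^ B l i ω ∂P = 1 - (α s(p, l) : ℝ) + α s(p, l) * s := by
    intro i
    have := (h.law_thinning p l hp i).integral_comp (f := fun n => s ^ n)
      (measurable_of_countable _).aestronglyMeasurable
    rw [integral_bernoulliMeasure] at this
    rw [show (fun ω => s ^ B l i ω) = (fun n => s ^ n) ∘ B l i from rfl, this]
    simp
    ring
  have h3 : ∀ ω, s ^ (L l ω + ∑ i ∈ Finset.range k, B l i ω)
      = s ^ L l ω * ∏ i : Fin k, s ^ B l i ω := by
    intro ω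
    rw [pow_add, ← Finset.prod_pow_eq_pow_sum, Finset.prod_range]
  simp_rw [h3]
  refine Eq.trans key ?_
  change (∫ ω, s ^ L l ω ∂P) * ∏ i : Fin k, ∫ ω, s ^ B l i ω ∂P = _
  simp_rw [h1, h2, Finset.prod_const, Finset.card_univ, Fintype.card_fin]

/-- If `S` contains with each vertex its ancestors, then `N v` for `v ∈ S` depends on the
innovations in `S` only. -/
lemma IsRepresentation.measurable_innovations (hT : T.IsTree)
    (h : IsRepresentation lam α T r P L B N) {S : Set V}
    (hS : ∀ p v, IsChild T r p v → v ∈ S → p ∈ S) (v : V) (hv : v ∈ S) :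
    Measurable[innovations L B S] (N v) := by
  induction hn : T.dist r v using Nat.strong_induction_on generalizing v with
  | _ n ih =>
    by_cases hvr : v = r
    · subst hvr
      have : N v = L v := funext h.eq_root
      rw [this]
      exact measurable_innovations_left hv
    · obtain ⟨p, hp⟩ := exists_parent hT hvr
      have hNp := ih (T.dist r p) (by rw [← hn, hp.2]; omega) p (hS p v hp hv) rfl
      have : N v = fun ω => L v ω + ∑ i ∈ Finset.range (N p ω), B v i ω :=
        funext (h.eq_child p v hp)
      rw [this]
      exact (measurable_innovations_left hv).add
        (measurable_sum_range hNp fun i => measurable_innovations_right hv i)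

variable [Fintype V]

/-- The variables of a representation can be replaced by measurable ones. Off a null set nothing
changes, and on it all variables are set to `0`, which preserves the recursion. The variables
`B r i` at the root, about which nothing is known and which are never used, are also set to `0`. -/
lemma IsRepresentation.exists_measurable (hT : T.IsTree)
    (h : IsRepresentation lam α T r P L B N) :
    ∃ (L' : V → Ω → ℕ) (B' : V → ℕ → Ω → ℕ) (N' : V → Ω → ℕ),
      IsRepresentation lam α T r P L' B' N' ∧ (∀ v, Measurable (L' v)) ∧
      (∀ v i, Measurable (B' v i)) ∧ ∀ᵐ ω ∂P, ∀ v, N v ω = N' v ω := by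
  have hLm : ∀ v, AEMeasurable (L v) P := by
    intro v
    by_cases hv : v = r
    · subst hv; exact h.law_root.aemeasurable
    · obtain ⟨p, hp⟩ := exists_parent hT hv
      exact (h.law_shock p v hp).aemeasurable
  let B₁ : V → ℕ → Ω → ℕ := fun v i => if v = r then fun _ => 0 else B v i
  have hB₁ : ∀ v, v ≠ r → B₁ v = B v := fun v hv => by simp [B₁, hv]
  have hBm : ∀ v i, AEMeasurable (B₁ v i) P := by
    intro v i
    by_cases hv : v = r
    · simp only [B₁, hv, if_true]; exact aemeasurable_const
    · rw [hB₁ v hv]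
      obtain ⟨p, hp⟩ := exists_parent hT hv
      exact (h.law_thinning p v hp i).aemeasurable
  have hind : iIndepFun (Sum.elim L (fun k : V × ℕ => B₁ k.1 k.2)) P := by
    have := h.indep.comp
      (fun k => if k.elim (fun _ => False) (fun k => k.1 = r) then fun _ => 0 else id)
      (fun k => measurable_of_countable _)
    convert this using 1
    funext k
    rcases k with v | ⟨v, i⟩
    · simp
    · by_cases hv : v = r
      · simp [B₁, hv]; rfl
      · simp [B₁, hv]
  have hae : ∀ᵐ ω ∂P, (∀ v, L v ω = (hLm v).mk _ ω) ∧ ∀ v i, B₁ v i ω = (hBm v i).mk _ ω :=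
    (ae_all_iff.2 fun v => (hLm v).ae_eq_mk).and
      (ae_all_iff.2 fun v => ae_all_iff.2 fun i => (hBm v i).ae_eq_mk)
  obtain ⟨s, hs, hsm, hs'⟩ := hae.exists_measurable_mem
  have hind_ae : ∀ f : Ω → ℕ, f =ᵐ[P] s.indicator f := fun f => by
    filter_upwards [hs] with ω hω
    rw [Set.indicator_of_mem hω]
  refine ⟨fun v => s.indicator (L v), fun v i => s.indicator (B₁ v i), fun v => s.indicator (N v),
    ⟨?_, ?_, ?_, ?_, ?_, ?_⟩, ?_, ?_, ?_⟩
  · refine hind.congr fun k => ?_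
    rcases k with v | ⟨v, i⟩
    · exact hind_ae _
    · exact hind_ae _
  · exact h.law_root.congr (hind_ae _).symm
  · exact fun p v hp => (h.law_shock p v hp).congr (hind_ae _).symm
  · intro p v hp i
    have hv : v ≠ r := by rintro rfl; exact not_isChild_root hp
    have := (h.law_thinning p v hp i).congr (hind_ae _).symm
    rwa [hB₁ v hv]
  · intro ω
    by_cases hω : ω ∈ s
    · simp [hω, h.eq_root ω]
    · simp [hω]
  · intro p v hp ω
    have hv : v ≠ r := by rintro rfl; exact not_isChild_root hp
    by_cases hω : ω ∈ s
    · simp [hω, hB₁ v hv, h.eq_child p v hp ω]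
    · simp [hω]
  · intro v
    have : s.indicator (L v) = s.indicator ((hLm v).mk _) := by
      ext ω
      by_cases hω : ω ∈ s
      · simp [hω, (hs' ω hω).1 v]
      · simp [hω]
    simp only [this]
    exact (hLm v).measurable_mk.indicator hsm
  · intro v i
    have : s.indicator (B₁ v i) = s.indicator ((hBm v i).mk _) := by
      ext ω
      by_cases hω : ω ∈ s
      · simp [hω, (hs' ω hω).2 v i]
      · simp [hω]
    simp only [this]
    exact (hBm v i).measurable_mk.indicator hsm
  · filter_upwards [hs] with ω hω v
    simp [hω]

/-- Integrating out a vertex `l` that is not the parent of any vertex of `S`. -/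
lemma IsRepresentation.integral_leaf [IsProbabilityMeasure P] (hT : T.IsTree)
    (h : IsRepresentation lam α T r P L B N) (hL : ∀ v, Measurable (L v))
    (hB : ∀ v i, Measurable (B v i)) {S : Finset V}
    (hS : ∀ p v, IsChild T r p v → v ∈ S → p ∈ S) {p l : V} (hp : IsChild T r p l)
    (hpS : p ∈ S) (hl : l ∉ S) {t : V → ℝ} (ht : ∀ v, |t v| ≤ 1) {s : ℝ} (hs : |s| ≤ 1) :
    ∫ ω, (∏ v ∈ S, t v ^ N v ω) * s ^ N l ω ∂P
      = Real.exp (lam * ((1 - α s(p, l)) * s - (1 - α s(p, l))))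
        * ∫ ω, (∏ v ∈ S, t v ^ N v ω) * (1 - (α s(p, l) : ℝ) + α s(p, l) * s) ^ N p ω ∂P := by
  let Y : Ω → V → ℕ := fun ω v => if v ∈ S then N v ω else 0
  let Z : Ω → ℕ × (ℕ → ℕ) := fun ω => (L l ω, fun i => B l i ω)
  have hYS : ∀ ω, ∀ v ∈ S, Y ω v = N v ω := fun ω v hv => by simp [Y, hv]
  have hYprod : ∀ ω, ∏ v ∈ S, t v ^ Y ω v = ∏ v ∈ S, t v ^ N v ω := fun ω =>
    Finset.prod_congr rfl fun v hv => by rw [hYS ω v hv]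
  have hξ : ∀ k, Measurable (Sum.elim L (fun k : V × ℕ => B k.1 k.2) k) := by
    rintro (v | ⟨v, i⟩)
    · exact hL v
    · exact hB v i
  have hle : ∀ S : Set V, innovations L B S ≤ ‹MeasurableSpace Ω› := fun S =>
    iSup₂_le fun k _ => (hξ k).comap_le
  have hY' : Measurable[innovations L B (S : Set V)] Y := by
    refine @measurable_pi_lambda _ _ _ (innovations L B (S : Set V)) _ _ fun v => ?_
    by_cases hv : v ∈ S
    · simp only [Y, hv, if_true]
      exact h.measurable_innovations hT (fun p v hpv hv => hS p v hpv hv) v hv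
    · simp only [Y, hv, if_false]
      exact measurable_const
  have hZ' : Measurable[innovations L B {l}] Z := by
    refine (measurable_innovations_left (Set.mem_singleton l)).prodMk ?_
    exact @measurable_pi_lambda _ _ _ (innovations L B {l}) _ _ fun i =>
      measurable_innovations_right (Set.mem_singleton l) i
  have hY : Measurable Y := hY'.mono (hle _) le_rfl
  have hZ : Measurable Z := hZ'.mono (hle _) le_rfl
  have hindep : IndepFun Y Z P := by
    have h1 : Indep (innovations L B (S : Set V)) (innovations L B {l}) P := by
      refine indep_iSup_of_disjoint (fun k => (hξ k).comap_le) h.indep ?_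
      rw [Set.disjoint_left]
      rintro k hk hk'
      simp only [Set.mem_ofPred_eq, Set.mem_singleton_iff, Finset.mem_coe] at hk hk'
      exact hl (hk' ▸ hk)
    exact indep_of_indep_of_le_left (indep_of_indep_of_le_right h1 hZ'.comap_le) hY'.comap_le
  have hmap := hindep.map_prod_eq_prod_map_map hY.aemeasurable hZ.aemeasurable
  have : IsProbabilityMeasure (P.map Y) := Measure.isProbabilityMeasure_map hY.aemeasurable
  have : IsProbabilityMeasure (P.map Z) := Measure.isProbabilityMeasure_map hZ.aemeasurable
  let F : (V → ℕ) → ℝ := fun y => ∏ v ∈ S, t v ^ y v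
  let G : (V → ℕ) × (ℕ × (ℕ → ℕ)) → ℝ := fun q =>
    F q.1 * s ^ (q.2.1 + ∑ i ∈ Finset.range (q.1 p), q.2.2 i)
  have hF : Measurable F := measurable_of_countable _
  have hG : Measurable G := by
    refine (hF.comp measurable_fst).mul ((measurable_of_countable (fun n : ℕ => s ^ n)).comp ?_)
    refine (measurable_fst.comp measurable_snd).add (measurable_sum_range ?_ fun i => ?_)
    · exact (measurable_pi_apply p).comp measurable_fst
    · exact (measurable_pi_apply i).comp (measurable_snd.comp measurable_snd)
  have hGb : ∀ q, ‖G q‖ ≤ 1 := by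
    intro q
    rw [Real.norm_eq_abs, abs_mul, abs_pow]
    exact mul_le_one₀ (abs_prod_pow_le_one S ht _) (pow_nonneg (abs_nonneg _) _)
      (pow_le_one₀ (abs_nonneg _) hs)
  have hGint : Integrable G ((P.map Y).prod (P.map Z)) :=
    Integrable.of_bound hG.aestronglyMeasurable 1 (Filter.Eventually.of_forall hGb)
  have h1 : ∫ ω, (∏ v ∈ S, t v ^ N v ω) * s ^ N l ω ∂P = ∫ ω, G (Y ω, Z ω) ∂P := by
    refine integral_congr_ae (Filter.Eventually.of_forall fun ω => ?_)
    simp only [G, F, Z]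
    rw [hYS ω p hpS, hYprod, h.eq_child p l hp ω]
  have h2 : ∫ ω, G (Y ω, Z ω) ∂P = ∫ q, G q ∂((P.map Y).prod (P.map Z)) := by
    rw [← hmap, integral_map (hY.prodMk hZ).aemeasurable hG.aestronglyMeasurable]
  rw [h1, h2, integral_prod _ hGint, integral_map hY.aemeasurable
    hGint.integral_prod_left.aestronglyMeasurable, ← integral_const_mul]
  refine integral_congr_ae (Filter.Eventually.of_forall fun ω => ?_)
  have hGm : Measurable fun z => G (Y ω, z) := hG.comp measurable_prodMk_left
  simp only
  rw [integral_map hZ.aemeasurable hGm.aestronglyMeasurable]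
  simp only [G, F, Z]
  rw [integral_const_mul, hYS ω p hpS, h.integral_pow_child hL hB hp, hYprod]
  ring

end Representation

end Law

section JointLaw

open scoped Classical

variable {V : Type*} [Fintype V] {lam : ℝ≥0} {α : Sym2 V → I} {T : SimpleGraph V} {r : V}

/-! ### The joint generating function of the field -/

lemma image_parent_eq_edgeFinset (hT : T.IsTree) {pa : V → V}
    (hpa : ∀ v, v ≠ r → IsChild T r (pa v) v) :
    (Finset.univ.erase r).image (fun v => s(pa v, v)) = T.edgeFinset := by
  ext e
  induction e with
  | h x y =>
    have hch : ∀ x y, IsChild T r x y →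
        s(x, y) ∈ (Finset.univ.erase r).image (fun v => s(pa v, v)) := by
      intro x y h
      have hy : y ≠ r := by rintro rfl; exact not_isChild_root h
      refine Finset.mem_image.2 ⟨y, by simp [hy], ?_⟩
      rw [isChild_parent_unique hT.isAcyclic (hpa y hy) h]
    rw [SimpleGraph.mem_edgeFinset, SimpleGraph.mem_edgeSet]
    constructor
    · intro h
      obtain ⟨v, hv, h⟩ := Finset.mem_image.1 h
      rw [← SimpleGraph.mem_edgeSet, ← h, SimpleGraph.mem_edgeSet]
      exact (hpa v (Finset.ne_of_mem_erase hv)).1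
    · intro h
      rcases (adj_iff_isChild (r := r) hT.isAcyclic (hT.connected.preconnected r x)).1 h with h | h
      · exact hch x y h
      · rw [Sym2.eq_swap]
        exact hch y x h

/-- The joint generating function of the counts in a set `S` of vertices that contains the root
and the ancestors of its elements. In the induction a vertex of `S` at maximal distance from the
root is integrated out, which changes the argument at its parent. Vertices outside `S` are isolated
in the edge set used here; having argument `1`, they cancel from the exponent. -/
lemma IsRepresentation.integral_prod_pow {Ω : Type*} [MeasurableSpace Ω] {P : Measure Ω}
    [IsProbabilityMeasure P] {L : V → Ω → ℕ} {B : V → ℕ → Ω → ℕ} {N : V → Ω → ℕ} (hT : T.IsTree)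
    (h : IsRepresentation lam α T r P L B N) (hL : ∀ v, Measurable (L v))
    (hB : ∀ v i, Measurable (B v i)) {pa : V → V} (hpa : ∀ v, v ≠ r → IsChild T r (pa v) v)
    (S : Finset V) (hr : r ∈ S) (hS : ∀ p v, IsChild T r p v → v ∈ S → p ∈ S)
    (t : V → ℝ) (ht : ∀ v, |t v| ≤ 1) (htS : ∀ v, v ∉ S → t v = 1) :
    ∫ ω, ∏ v ∈ S, t v ^ N v ω ∂P
      = Real.exp (lam *
        (clusterSum (fun e => (α e : ℝ)) (fun c => ∏ v ∈ c, t v)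
            ((S.erase r).image (fun v => s(pa v, v)))
          - clusterSum (fun e => (α e : ℝ)) (fun c => ∏ _v ∈ c, 1)
            ((S.erase r).image (fun v => s(pa v, v))))) := by
  induction hn : S.card generalizing S t with
  | zero => exact absurd hr (by rw [Finset.card_eq_zero.1 hn]; simp)
  | succ n ih =>
    by_cases hne : (S.erase r).Nonempty
    · obtain ⟨l, hl, hmax⟩ := Finset.exists_max_image (S.erase r) (fun v => T.dist r v) hne
      obtain ⟨hlr, hlS⟩ := Finset.mem_erase.1 hl
      have hp := hpa l hlr
      set p := pa l with hpdef
      have hpl : p ≠ l := hp.1.ne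
      have hpS : p ∈ S.erase l := Finset.mem_erase.2 ⟨hpl, hS p l hp hlS⟩
      have hS' : ∀ q v, IsChild T r q v → v ∈ S.erase l → q ∈ S.erase l := by
        intro q v hqv hv
        obtain ⟨_, hvS⟩ := Finset.mem_erase.1 hv
        refine Finset.mem_erase.2 ⟨?_, hS q v hqv hvS⟩
        rintro rfl
        have hvr : v ≠ r := by rintro rfl; exact not_isChild_root hqv
        have h1 := hmax v (Finset.mem_erase.2 ⟨hvr, hvS⟩)
        have h2 := hqv.2
        omega
      have hr' : r ∈ S.erase l := Finset.mem_erase.2 ⟨Ne.symm hlr, hr⟩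
      set E' := ((S.erase l).erase r).image (fun v => s(pa v, v)) with hE'
      have hE : (S.erase r).image (fun v => s(pa v, v)) = insert s(p, l) E' := by
        rw [hE', Finset.erase_right_comm, hpdef,
          ← Finset.image_insert (fun v => s(pa v, v)), Finset.insert_erase hl]
      have hlE' : ∀ x, s(l, x) ∉ E' := by
        intro x hx
        obtain ⟨v, hv, hvx⟩ := Finset.mem_image.1 hx
        obtain ⟨hvr, hv⟩ := Finset.mem_erase.1 hv
        have hpv := hS' _ _ (hpa v hvr) hv
        rcases Sym2.eq_iff.1 hvx with ⟨h1, _⟩ | ⟨_, h1⟩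
        · exact Finset.notMem_erase l S (h1 ▸ hpv)
        · exact Finset.notMem_erase l S (h1 ▸ hv)
      -- the arguments with `l` left out, and with the parent's argument adjusted
      set t₀ : V → ℝ := Function.update t l 1 with ht₀
      set b : ℝ := 1 - (α s(p, l) : ℝ) + α s(p, l) * t l with hb
      set t₁ : V → ℝ := Function.update t₀ p (t₀ p * b) with ht₁
      have ht₀l : t₀ l = 1 := by simp [ht₀]
      have ht₀' : ∀ v, v ≠ l → t₀ v = t v := fun v hv => by simp [ht₀, hv]
      have ht₀_le : ∀ v, |t₀ v| ≤ 1 := by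
        intro v
        by_cases hv : v = l
        · rw [hv, ht₀l]; simp
        · rw [ht₀' v hv]; exact ht v
      have ht₁_le : ∀ v, |t₁ v| ≤ 1 := by
        intro v
        by_cases hv : v = p
        · rw [hv, ht₁, Function.update_self, abs_mul]
          exact mul_le_one₀ (ht₀_le p) (abs_nonneg _) (abs_thinning_le_one _ (ht l))
        · rw [ht₁, Function.update_of_ne hv]; exact ht₀_le v
      have ht₁S : ∀ v, v ∉ S.erase l → t₁ v = 1 := by
        intro v hv
        have hvp : v ≠ p := fun h => hv (h ▸ hpS)
        rw [ht₁, Function.update_of_ne hvp]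
        by_cases hvl : v = l
        · rw [hvl, ht₀l]
        · rw [ht₀' v hvl]
          exact htS v fun h => hv (Finset.mem_erase.2 ⟨hvl, h⟩)
      have hstep : ∫ ω, ∏ v ∈ S, t v ^ N v ω ∂P
          = Real.exp (lam * ((1 - α s(p, l)) * t l - (1 - α s(p, l))))
            * ∫ ω, ∏ v ∈ S.erase l, t₁ v ^ N v ω ∂P := by
        have h1 : ∀ ω, ∏ v ∈ S, t v ^ N v ω = (∏ v ∈ S.erase l, t v ^ N v ω) * t l ^ N l ω :=
          fun ω => (Finset.prod_erase_mul S (fun v => t v ^ N v ω) hlS).symm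
        have h2 : ∀ ω, ∏ v ∈ S.erase l, t₁ v ^ N v ω
            = (∏ v ∈ S.erase l, t v ^ N v ω) * b ^ N p ω := by
          intro ω
          rw [← Finset.prod_erase_mul _ (fun v => t v ^ N v ω) hpS,
            ← Finset.prod_erase_mul _ (fun v => t₁ v ^ N v ω) hpS]
          have h3 : ∀ v ∈ (S.erase l).erase p, t₁ v ^ N v ω = t v ^ N v ω := by
            intro v hv
            obtain ⟨hvp, hv⟩ := Finset.mem_erase.1 hv
            rw [ht₁, Function.update_of_ne hvp, ht₀' v (Finset.ne_of_mem_erase hv)]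
          rw [Finset.prod_congr rfl h3, ht₁, Function.update_self, ht₀' p hpl, mul_pow]
          ring
        simp_rw [h1, h2]
        exact h.integral_leaf hT hL hB hS' hp hpS (Finset.notMem_erase l S) ht (ht l)
      have hg := clusterSum_insert_leaf (fun e => (α e : ℝ)) t₀ hpl hlE' ht₀l (t l)
      have hg1 := clusterSum_insert_leaf (fun e => (α e : ℝ)) (fun _ => 1) hpl hlE' rfl 1
      have hu : Function.update t₀ l (t l) = t := by simp [ht₀]
      have hu1 : ∀ x : V, Function.update (fun _ : V => (1 : ℝ)) x 1 = fun _ => 1 := fun x => by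
        simp
      simp only [mul_one, sub_add_cancel] at hg1
      rw [hu] at hg
      rw [hu1, hu1] at hg1
      rw [hstep, ih (S.erase l) hr' hS' t₁ ht₁_le ht₁S (by
        rw [Finset.card_erase_of_mem hlS, hn]; rfl), hE, hg, hg1, ← Real.exp_add]
      congr 1
      simp only [ht₁, hb]
      ring
    · have hE : S.erase r = ∅ := Finset.not_nonempty_iff_eq_empty.1 hne
      have hSr : S = {r} := by
        rw [← Finset.insert_erase hr, hE]
        rfl
      have htr : t = Function.update (fun _ => 1) r (1 * t r) := by
        funext v
        by_cases hv : v = r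
        · rw [hv]; simp
        · rw [Function.update_of_ne hv]
          exact htS v (by simp [hSr, hv])
      have hg := clusterSum_update (fun e => (α e : ℝ)) (fun _ : V => (1 : ℝ)) ∅ r (t r)
      rw [← htr] at hg
      rw [hE, Finset.image_empty, hg, hSr]
      have hX := h.law_root.integral_comp (f := fun n => t r ^ n)
        (measurable_of_countable _).aestronglyMeasurable
      rw [integral_pow_poissonMeasure] at hX
      simp only [Finset.prod_singleton, h.eq_root]
      refine Eq.trans hX ?_
      simp [perc_empty]

/-- The joint generating function of a Poisson tree-structured Markov random field. The formula
does not refer to the root of the representation. -/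
theorem IsMPMRF.integral_prod_pow (hT : T.IsTree) {Ω : Type*} [MeasurableSpace Ω]
    {P : Measure Ω} {N : V → Ω → ℕ} (h : IsMPMRF lam α T P N) {t : V → ℝ}
    (ht : ∀ v, |t v| ≤ 1) :
    ∫ ω, ∏ v, t v ^ N v ω ∂P
      = Real.exp (lam *
        (clusterSum (fun e => (α e : ℝ)) (fun c => ∏ v ∈ c, t v) T.edgeFinset
          - clusterSum (fun e => (α e : ℝ)) (fun c => ∏ _v ∈ c, 1) T.edgeFinset)) := by
  obtain ⟨r, Ω₀, _, P₀, L, B, N₀, _, hrep, hid⟩ := h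
  obtain ⟨L', B', N', hrep', hL, hB, hae⟩ := hrep.exists_measurable hT
  have hpa : ∀ v, ∃ p, v ≠ r → IsChild T r p v := fun v => by
    by_cases hv : v = r
    · exact ⟨v, fun h => absurd hv h⟩
    · obtain ⟨p, hp⟩ := exists_parent hT hv
      exact ⟨p, fun _ => hp⟩
  choose pa hpa using hpa
  have h1 : ∫ ω, ∏ v, t v ^ N v ω ∂P = ∫ ω, ∏ v, t v ^ N₀ v ω ∂P₀ :=
    (hid.comp (u := fun n : V → ℕ => ∏ v, t v ^ n v) (measurable_of_countable _)).integral_eq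
  have h2 : ∫ ω, ∏ v, t v ^ N₀ v ω ∂P₀ = ∫ ω, ∏ v, t v ^ N' v ω ∂P₀ := by
    refine integral_congr_ae ?_
    filter_upwards [hae] with ω hω
    simp_rw [hω]
  rw [h1, h2, hrep'.integral_prod_pow hT hL hB hpa Finset.univ (Finset.mem_univ r)
    (fun _ _ _ _ => Finset.mem_univ _) t ht (fun v hv => absurd (Finset.mem_univ v) hv),
    image_parent_eq_edgeFinset hT hpa]

end JointLaw

open Polynomial

/-! ### Polynomials with nonnegative coefficients and convex functions -/

/-- The polynomials with nonnegative coefficients. -/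
def nonnegPoly : Subsemiring ℝ[X] where
  carrier := {p | ∀ k, 0 ≤ p.coeff k}
  mul_mem' {p q} hp hq k := by
    rw [coeff_mul]
    exact Finset.sum_nonneg fun x _ => mul_nonneg (hp _) (hq _)
  one_mem' k := by
    rw [coeff_one]
    split_ifs <;> norm_num
  add_mem' {p q} hp hq k := by
    rw [coeff_add]
    exact add_nonneg (hp k) (hq k)
  zero_mem' k := by simp

lemma X_mem_nonnegPoly : (X : ℝ[X]) ∈ nonnegPoly := fun k => by
  rw [coeff_X]
  split_ifs <;> norm_num

lemma C_mem_nonnegPoly {a : ℝ} (ha : 0 ≤ a) : (C a : ℝ[X]) ∈ nonnegPoly := fun k => by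
  rw [coeff_C]
  split_ifs
  exacts [ha, le_rfl]

/-- The linear functional `∑ₖ pₖ Xᵏ ↦ ∑ₖ pₖ φ(k)`, the integral of `φ` against the (signed) measure
on `ℕ` of which `p` is the generating function. -/
noncomputable def pairing (φ : ℕ → ℝ) : ℝ[X] →ₗ[ℝ] ℝ :=
  lsum fun k => φ k • LinearMap.id

lemma pairing_apply (φ : ℕ → ℝ) (p : ℝ[X]) :
    pairing φ p = ∑ k ∈ p.support, p.coeff k * φ k := by
  simp [pairing, lsum, sum_def, mul_comm]

lemma hasSum_pairing (φ : ℕ → ℝ) (p : ℝ[X]) :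
    HasSum (fun k => p.coeff k * φ k) (pairing φ p) := by
  rw [pairing_apply]
  refine hasSum_sum_of_ne_finset_zero fun k hk => ?_
  rw [notMem_support_iff.1 hk, zero_mul]

lemma pairing_pow (t : ℝ) (p : ℝ[X]) : pairing (fun k => t ^ k) p = p.eval t := by
  rw [pairing_apply, eval_eq_sum, sum_def]

lemma pairing_C_mul_X_pow (φ : ℕ → ℝ) (a : ℝ) (k : ℕ) : pairing φ (C a * X ^ k) = a * φ k := by
  rw [C_mul_X_pow_eq_monomial]
  simp [pairing, lsum, sum_monomial_index, mul_comm]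

/-- A second difference of a convex function is nonnegative, so a convex function pairs
nonnegatively with every multiple of `(X - 1)²` by a polynomial with nonnegative coefficients. -/
lemma pairing_nonneg {φ : ℝ → ℝ} (hφ : ConvexOn ℝ Set.univ φ) {q : ℝ[X]}
    (hq : q ∈ nonnegPoly) : 0 ≤ pairing (fun k => φ k) ((X - 1) ^ 2 * q) := by
  have hexp : (X - 1) ^ 2 * q = ∑ j ∈ q.support,
      (C (q.coeff j) * X ^ (j + 2) - C (2 * q.coeff j) * X ^ (j + 1)
        + C (q.coeff j) * X ^ j) := by
    conv_lhs => rw [q.as_sum_support_C_mul_X_pow, Finset.mul_sum]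
    refine Finset.sum_congr rfl fun j _ => ?_
    rw [C_mul, show (C 2 : ℝ[X]) = 2 from rfl]
    ring
  rw [hexp, map_sum]
  refine Finset.sum_nonneg fun j _ => ?_
  rw [map_add, map_sub, pairing_C_mul_X_pow, pairing_C_mul_X_pow, pairing_C_mul_X_pow]
  have h := hφ.2 (Set.mem_univ ((j : ℝ) + 2)) (Set.mem_univ (j : ℝ)) 
    (by norm_num : (0 : ℝ) ≤ 1 / 2) (by norm_num : (0 : ℝ) ≤ 1 / 2) (by norm_num)
  have hmid : (1 / 2 : ℝ) • ((j : ℝ) + 2) + (1 / 2 : ℝ) • (j : ℝ) = j + 1 := by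
    simp only [smul_eq_mul]; ring
  rw [hmid, smul_eq_mul, smul_eq_mul] at h
  have h2 := hq j
  push_cast
  nlinarith

/-- Write `p'ⁿ - pⁿ = (∑ p'ⁱ pʲ) (p' - p)` and apply `pairing_nonneg`. -/
lemma pairing_pow_le {φ : ℝ → ℝ} (hφ : ConvexOn ℝ Set.univ φ) {p p' q : ℝ[X]}
    (hp : p ∈ nonnegPoly) (hp' : p' ∈ nonnegPoly) (hq : q ∈ nonnegPoly)
    (h : p' - p = (X - 1) ^ 2 * q) (n : ℕ) :
    pairing (fun k => φ k) (p ^ n) ≤ pairing (fun k => φ k) (p' ^ n) := by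
  rw [← sub_nonneg, ← map_sub, ← (Commute.all p' p).geom_sum₂_mul, h, mul_left_comm]
  refine pairing_nonneg hφ (mul_mem (sum_mem fun i _ => ?_) hq)
  exact mul_mem (pow_mem hp' _) (pow_mem hp _)

/-- Division by `X - 1` produces the negated partial sums of the coefficients. -/
lemma exists_eq_X_sub_one_mul {p : ℝ[X]} (hp : p.eval 1 = 0) :
    ∃ q : ℝ[X], p = (X - 1) * q ∧ ∀ i, q.coeff i = -∑ k ∈ Finset.range (i + 1), p.coeff k := by
  obtain ⟨q, hq⟩ := dvd_iff_isRoot.2 (show p.IsRoot 1 from hp)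
  have h0 : p.coeff 0 = -q.coeff 0 := by rw [hq]; simp [sub_mul]
  have hs : ∀ k, p.coeff (k + 1) = q.coeff k - q.coeff (k + 1) := fun k => by
    rw [hq, coeff_X_sub_C_mul, one_mul]
  refine ⟨q, by simpa using hq, fun i => ?_⟩
  induction i with
  | zero => simp [h0]
  | succ i ih => rw [Finset.sum_range_succ, neg_add, ← ih, hs]; ring

lemma sum_range_coeff_le {p : ℝ[X]} (hp : p ∈ nonnegPoly) (n : ℕ) :
    ∑ k ∈ Finset.range n, p.coeff k ≤ p.eval 1 := by
  have h := hasSum_pairing (fun k => 1 ^ k) p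
  rw [pairing_pow] at h
  simp only [one_pow, mul_one] at h
  exact sum_le_hasSum _ (fun k _ => hp k) h

/-! ### Measures on the natural numbers and their generating functions -/

lemma hasSum_integral_nat {μ : Measure ℕ} {f : ℕ → ℝ} (hf : Integrable f μ) :
    HasSum (fun k => μ.real {k} * f k) (∫ k, f k ∂μ) := by
  have hf' := hf
  rw [← Measure.sum_smul_dirac μ] at hf'
  have h := hasSum_integral_measure hf'
  rw [Measure.sum_smul_dirac] at h
  simp only [integral_smul_measure, integral_dirac, smul_eq_mul] at h
  exact h

lemma integrable_pow_nat (μ : Measure ℕ) [IsFiniteMeasure μ] {t : ℝ} (ht : |t| ≤ 1) :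
    Integrable (fun k => t ^ k) μ := by
  refine Integrable.of_bound (measurable_of_countable _).aestronglyMeasurable 1
    (Filter.Eventually.of_forall fun k => ?_)
  rw [Real.norm_eq_abs, abs_pow]
  exact pow_le_one₀ (abs_nonneg _) ht

/-- Two power series that converge to the same function on `[-1, 1]` have the same coefficients. -/
lemma eq_of_hasSum_pow {a b : ℕ → ℝ} {f : ℝ → ℝ}
    (ha : ∀ t, |t| ≤ 1 → HasSum (fun k => a k * t ^ k) (f t))
    (hb : ∀ t, |t| ≤ 1 → HasSum (fun k => b k * t ^ k) (f t)) : a = b := by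
  have key : ∀ c : ℕ → ℝ, (∀ t, |t| ≤ 1 → HasSum (fun k => c k * t ^ k) (f t)) →
      HasFPowerSeriesAt f (FormalMultilinearSeries.ofScalars ℝ c) 0 := by
    intro c hc
    rw [hasFPowerSeriesAt_iff]
    filter_upwards [Metric.closedBall_mem_nhds (0 : ℝ) one_pos] with t ht
    rw [zero_add]
    simpa [FormalMultilinearSeries.coeff_ofScalars, mul_comm] using hc t (by simpa using ht)
  have h := (key a ha).eq_formalMultilinearSeries (key b hb)
  funext k
  rw [← FormalMultilinearSeries.coeff_ofScalars (𝕜 := ℝ) (p := a), h,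
    FormalMultilinearSeries.coeff_ofScalars]

lemma measureReal_eq_coeff {μ : Measure ℕ} [IsFiniteMeasure μ] {p : ℝ[X]}
    (h : ∀ t ∈ Set.Icc (-1 : ℝ) 1, ∫ k, t ^ k ∂μ = p.eval t) (k : ℕ) :
    μ.real {k} = p.coeff k := by
  refine congrFun (eq_of_hasSum_pow (f := fun t => p.eval t) (a := fun k => μ.real {k})
    (b := fun k => p.coeff k) (fun t ht => ?_) fun t _ => ?_) k
  · rw [← h t (abs_le.1 ht)]
    exact hasSum_integral_nat (integrable_pow_nat μ ht)
  · have h1 := hasSum_pairing (fun k => t ^ k) p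
    rwa [pairing_pow] at h1

/-- A measure with generating function `exp (p(t) - p(1))` is a Poisson mixture of the measures
with generating functions `pⁿ` (up to normalization), and so are its integrals. -/
lemma hasSum_integral_of_pgf_eq_exp {μ : Measure ℕ} [IsFiniteMeasure μ] {p : ℝ[X]}
    (hp : p ∈ nonnegPoly)
    (h : ∀ t ∈ Set.Icc (-1 : ℝ) 1, ∫ k, t ^ k ∂μ = Real.exp (p.eval t - p.eval 1))
    {φ : ℕ → ℝ} (hφ : Integrable φ μ) :
    HasSum (fun n => Real.exp (-p.eval 1) / (n.factorial : ℝ) * pairing φ (p ^ n))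
      (∫ k, φ k ∂μ) := by
  set w : ℕ → ℝ := fun n => Real.exp (-p.eval 1) / (n.factorial : ℝ) with hw
  have hw0 : ∀ n, 0 ≤ w n := fun n => by positivity
  have hexp : ∀ t : ℝ, HasSum (fun n => w n * p.eval t ^ n)
      (Real.exp (p.eval t - p.eval 1)) := by
    intro t
    have h1 : HasSum (fun n : ℕ => p.eval t ^ n / (n.factorial : ℝ)) (Real.exp (p.eval t)) := by
      rw [Real.exp_eq_exp_ℝ]
      exact NormedSpace.expSeries_div_hasSum_exp (p.eval t)
    have h2 := h1.mul_left (Real.exp (-p.eval 1))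
    rw [← Real.exp_add, neg_add_eq_sub] at h2
    have h3 : (fun n => w n * p.eval t ^ n)
        = fun n : ℕ => Real.exp (-p.eval 1) * (p.eval t ^ n / (n.factorial : ℝ)) :=
      funext fun n => by simp only [hw]; ring
    rwa [h3]
  have hpt : ∀ (t : ℝ) (n : ℕ), HasSum (fun k => (p ^ n).coeff k * t ^ k) (p.eval t ^ n) := by
    intro t n
    have h1 := hasSum_pairing (fun k => t ^ k) (p ^ n)
    rwa [pairing_pow, eval_pow] at h1
  have hpn : ∀ n k, 0 ≤ (p ^ n).coeff k := fun n => pow_mem hp n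
  let F : ℕ × ℕ → ℝ := fun x => w x.1 * (p ^ x.1).coeff x.2
  have hF0 : ∀ x, 0 ≤ F x := fun x => mul_nonneg (hw0 _) (hpn _ _)
  have hFs : Summable F := by
    refine (summable_prod_of_nonneg (f := F) hF0).2 ⟨fun n => ?_, ?_⟩
    · have := (hpt 1 n).summable.mul_left (w n)
      simpa [F] using this
    · have h1 : ∀ n, ∑' k, F (n, k) = w n * p.eval 1 ^ n := by
        intro n
        have := ((hpt 1 n).mul_left (w n)).tsum_eq
        simpa [F] using this
      simp_rw [h1]
      exact (hexp 1).summable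
  have hFt : ∀ t : ℝ, |t| ≤ 1 → Summable fun x : ℕ × ℕ => F x * t ^ x.2 := by
    intro t ht
    refine Summable.of_norm_bounded hFs fun x => ?_
    rw [norm_mul, Real.norm_of_nonneg (hF0 x), Real.norm_eq_abs, abs_pow]
    exact mul_le_of_le_one_right (hF0 x) (pow_le_one₀ (abs_nonneg _) ht)
  have hmass : ∀ k, HasSum (fun n => F (n, k)) (μ.real {k}) := by
    have hcol : ∀ k, Summable fun n => F (n, k) := fun k =>
      hFs.comp_injective (i := fun n => (n, k)) fun a b hab => (Prod.ext_iff.1 hab).1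
    have : (fun k => μ.real {k}) = fun k => ∑' n, F (n, k) := by
      refine eq_of_hasSum_pow (f := fun t => ∫ k, t ^ k ∂μ)
        (fun t ht => hasSum_integral_nat (integrable_pow_nat μ ht)) fun t ht => ?_
      have h1 : HasSum (fun x : ℕ × ℕ => F x * t ^ x.2) (Real.exp (p.eval t - p.eval 1)) := by
        have h2 := (hFt t ht).hasSum
        have h3 := h2.prod_fiberwise fun n => by
          have := (hpt t n).mul_left (w n)
          simpa only [F, mul_assoc] using this
        rwa [h3.unique (hexp t)] at h2
      rw [h t (abs_le.1 ht)]
      have h4 : HasSum (fun x : ℕ × ℕ => F x.swap * t ^ x.1) (Real.exp (p.eval t - p.eval 1)) :=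
        (Equiv.prodComm ℕ ℕ).hasSum_iff.2 h1
      exact h4.prod_fiberwise fun k => (hcol k).hasSum.mul_right (t ^ k)
    intro k
    rw [congrFun this k]
    exact (hcol k).hasSum
  have hint := hasSum_integral_nat hφ
  have hnorm := hasSum_integral_nat hφ.norm
  have hsum : Summable fun x : ℕ × ℕ => F x.swap * φ x.1 := by
    rw [← summable_norm_iff]
    refine (summable_prod_of_nonneg fun x => norm_nonneg _).2 ⟨fun k => ?_, ?_⟩
    · simp_rw [norm_mul]
      exact ((hmass k).summable.norm).mul_right _
    · refine hnorm.summable.congr fun k => ?_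
      have : ∀ n, ‖F (Prod.swap (k, n)) * φ (k, n).1‖ = F (n, k) * ‖φ k‖ := fun n => by
        rw [norm_mul, Real.norm_of_nonneg (hF0 _)]
        rfl
      simp_rw [this]
      exact ((hmass k).mul_right _).tsum_eq.symm
  have h5 : HasSum (fun x : ℕ × ℕ => F x.swap * φ x.1) (∫ k, φ k ∂μ) := by
    have h6 := hsum.hasSum
    have h7 := h6.prod_fiberwise fun k => (hmass k).mul_right (φ k)
    rwa [h7.unique hint] at h6
  have h8 : HasSum (fun x : ℕ × ℕ => F x * φ x.2) (∫ k, φ k ∂μ) :=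
    (Equiv.prodComm ℕ ℕ).hasSum_iff.2 h5
  refine h8.prod_fiberwise fun n => ?_
  have := (hasSum_pairing φ (p ^ n)).mul_left (w n)
  simpa only [F, mul_assoc] using this

/-- Two compound Poisson laws whose jump generating functions, without normalization, differ by
`(X - 1)²` times a polynomial with nonnegative coefficients are ordered in the convex order. -/
lemma integral_le_of_pgf_eq_exp {μ μ' : Measure ℕ} [IsFiniteMeasure μ] [IsFiniteMeasure μ']
    {p p' q : ℝ[X]} (hp : p ∈ nonnegPoly) (hp' : p' ∈ nonnegPoly) (hq : q ∈ nonnegPoly)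
    (hpq : p' - p = (X - 1) ^ 2 * q)
    (h : ∀ t ∈ Set.Icc (-1 : ℝ) 1, ∫ k, t ^ k ∂μ = Real.exp (p.eval t - p.eval 1))
    (h' : ∀ t ∈ Set.Icc (-1 : ℝ) 1, ∫ k, t ^ k ∂μ' = Real.exp (p'.eval t - p'.eval 1))
    {φ : ℝ → ℝ} (hφ : ConvexOn ℝ Set.univ φ) (hi : Integrable (fun k : ℕ => φ k) μ)
    (hi' : Integrable (fun k : ℕ => φ k) μ') :
    ∫ k : ℕ, φ k ∂μ ≤ ∫ k : ℕ, φ k ∂μ' := by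
  have h1 : p'.eval 1 = p.eval 1 := by
    have := congrArg (eval 1) hpq
    simpa [sub_eq_zero] using this
  have hs := hasSum_integral_of_pgf_eq_exp hp h hi
  have hs' := hasSum_integral_of_pgf_eq_exp hp' h' hi'
  rw [h1] at hs'
  exact hasSum_le (fun n => mul_le_mul_of_nonneg_left (pairing_pow_le hφ hp hp' hq hpq n)
    (by positivity)) hs hs'

section Comparison

open Polynomial

open scoped Classical

/-! ### Moving an edge -/

lemma perc_congr_weight {ε R : Type*} [DecidableEq ε] [CommRing R] {a a' : ε → R} {E : Finset ε}
    (h : ∀ e ∈ E, a e = a' e) (f : Finset ε → R) : perc a E f = perc a' E f := by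
  refine Finset.sum_congr rfl fun ω hω => ?_
  have h1 : ∏ e ∈ ω, a e = ∏ e ∈ ω, a' e :=
    Finset.prod_congr rfl fun e he => h e (Finset.mem_powerset.1 hω he)
  have h2 : ∏ e ∈ E \ ω, (1 - a e) = ∏ e ∈ E \ ω, (1 - a' e) :=
    Finset.prod_congr rfl fun e he => by rw [h e (Finset.mem_sdiff.1 he).1]
  rw [h1, h2]

variable {V : Type*}

lemma perc_mem_nonnegPoly (α : Sym2 V → I) (E : Finset (Sym2 V)) {f : Finset (Sym2 V) → ℝ[X]}
    (hf : ∀ ω, f ω ∈ nonnegPoly) : perc (fun e => C (α e : ℝ)) E f ∈ nonnegPoly := by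
  refine sum_mem fun ω _ => mul_mem (mul_mem ?_ ?_) (hf ω)
  · exact prod_mem fun e _ => C_mem_nonnegPoly (α e).2.1
  · refine prod_mem fun e _ => ?_
    rw [← C_1, ← C_sub]
    exact C_mem_nonnegPoly (sub_nonneg.2 (α e).2.2)

variable [Fintype V]

/-- The generating function of the size of the cluster of `z`. -/
noncomputable def sizePoly (α : Sym2 V → I) (E : Finset (Sym2 V)) (z : V) : ℝ[X] :=
  perc (fun e => C (α e : ℝ)) E (fun ω => ∏ _v ∈ cluster ω z, X)

/-- The expected sum of `X ^ |c|` over the clusters `c`. -/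
noncomputable def clusterPoly (α : Sym2 V → I) (E : Finset (Sym2 V)) : ℝ[X] :=
  clusterSum (fun e => C (α e : ℝ)) (fun c => ∏ _v ∈ c, X) E

lemma sizePoly_mem_nonnegPoly (α : Sym2 V → I) (E : Finset (Sym2 V)) (z : V) :
    sizePoly α E z ∈ nonnegPoly :=
  perc_mem_nonnegPoly α E fun _ => prod_mem fun _ _ => X_mem_nonnegPoly

lemma clusterPoly_mem_nonnegPoly (α : Sym2 V → I) (E : Finset (Sym2 V)) :
    clusterPoly α E ∈ nonnegPoly :=
  perc_mem_nonnegPoly α E fun _ => sum_mem fun _ _ => prod_mem fun _ _ => X_mem_nonnegPoly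

lemma eval_sizePoly (α : Sym2 V → I) (E : Finset (Sym2 V)) (z : V) (t : ℝ) :
    (sizePoly α E z).eval t
      = perc (fun e => (α e : ℝ)) E (fun ω => ∏ _v ∈ cluster ω z, t) := by
  rw [sizePoly, ← coe_evalRingHom, map_perc]
  simp

lemma eval_clusterPoly (α : Sym2 V → I) (E : Finset (Sym2 V)) (t : ℝ) :
    (clusterPoly α E).eval t
      = clusterSum (fun e => (α e : ℝ)) (fun c => ∏ _v ∈ c, t) E := by
  rw [clusterPoly, clusterSum, ← coe_evalRingHom, map_perc]
  simp [clusterSum]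

lemma eval_one_sizePoly (α : Sym2 V → I) (E : Finset (Sym2 V)) (z : V) :
    (sizePoly α E z).eval 1 = 1 := by
  rw [eval_sizePoly]
  simp [perc_const]

lemma clusterPoly_insert (α : Sym2 V → I) {E : Finset (Sym2 V)} {x y : V} (h : ¬ Joined E x y) :
    clusterPoly α (insert s(x, y) E) = clusterPoly α E + C (α s(x, y) : ℝ) *
      (sizePoly α E x * sizePoly α E y - sizePoly α E x - sizePoly α E y) := by
  rw [clusterPoly, clusterSum_insert _ _ h, perc_sub, perc_sub]
  rw [perc_congr (f := fun ω => ∏ _v ∈ cluster ω x ∪ cluster ω y, (X : ℝ[X]))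
    (g := fun ω => (∏ _v ∈ cluster ω x, X) * ∏ _v ∈ cluster ω y, X) fun ω hω => by
      rw [Finset.prod_union (disjoint_cluster fun h' => h (h'.mono hω))],
    perc_mul_cluster _ (fun c => ∏ _v ∈ c, X) (fun c => ∏ _v ∈ c, X) h]
  rfl

/-- Moving the second end of an edge at `u` from `v` to `w` changes the cluster polynomial by a
product of two factors that each vanish at `1`. -/
lemma clusterPoly_insert_sub {α α' : Sym2 V → I} {E : Finset (Sym2 V)} {u v w : V}
    (hv : ¬ Joined E u v) (hw : ¬ Joined E u w) (hα : ∀ e ∈ E, α e = α' e)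
    (hαu : α s(u, v) = α' s(u, w)) :
    clusterPoly α' (insert s(u, w) E) - clusterPoly α (insert s(u, v) E)
      = C (α s(u, v) : ℝ) *
        ((sizePoly α E u - 1) * (sizePoly α E w - sizePoly α E v)) := by
  have hsize : ∀ z, sizePoly α' E z = sizePoly α E z := fun z =>
    perc_congr_weight (fun e he => by rw [hα e he]) _
  have hclus : clusterPoly α' E = clusterPoly α E :=
    perc_congr_weight (fun e he => by rw [hα e he]) _
  rw [clusterPoly_insert α hv, clusterPoly_insert α' hw, hclus, hsize, hsize, hαu]
  ring

/-- The total count has a compound Poisson generating function. -/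
lemma IsMPMRF.integral_pow_sum {lam : ℝ≥0} {α : Sym2 V → I} {T : SimpleGraph V} (hT : T.IsTree)
    {Ω : Type*} [MeasurableSpace Ω] {P : Measure Ω} {N : V → Ω → ℕ} (h : IsMPMRF lam α T P N)
    {t : ℝ} (ht : |t| ≤ 1) :
    ∫ ω, t ^ (∑ i, N i ω) ∂P = Real.exp ((C (lam : ℝ) * clusterPoly α T.edgeFinset).eval t
      - (C (lam : ℝ) * clusterPoly α T.edgeFinset).eval 1) := by
  have h1 := h.integral_prod_pow hT (t := fun _ => t) fun _ => ht
  simp_rw [Finset.prod_pow_eq_pow_sum] at h1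
  rw [h1, eval_mul, eval_mul, eval_C, eval_C, eval_clusterPoly, eval_clusterPoly, mul_sub]

lemma IsMPMRF.aemeasurable_sum {lam : ℝ≥0} {α : Sym2 V → I} {T : SimpleGraph V}
    {Ω : Type*} [MeasurableSpace Ω] {P : Measure Ω} {N : V → Ω → ℕ} (h : IsMPMRF lam α T P N) :
    AEMeasurable (fun ω => ∑ i, N i ω) P := by
  obtain ⟨_, _, _, _, _, _, _, _, _, hid⟩ := h
  exact (measurable_of_countable (fun n : V → ℕ => ∑ i, n i)).comp_aemeasurable
    hid.aemeasurable_fst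

lemma sum_range_measureReal {Ω : Type*} [MeasurableSpace Ω] (P : Measure Ω) [IsFiniteMeasure P]
    {H : Ω → ℕ} (hH : Measurable H) (n : ℕ) :
    ∑ k ∈ Finset.range (n + 1), (P.map H).real {k} = P.real {ω | H ω ≤ n} := by
  rw [sum_measureReal_singleton, map_measureReal_apply hH (MeasurableSet.of_discrete)]
  congr 1
  ext ω
  simp

lemma StochasticOrder.measureReal_le_le {Ω Ω' : Type*} [MeasurableSpace Ω] [MeasurableSpace Ω']
    {P : Measure Ω} {P' : Measure Ω'} [IsProbabilityMeasure P] [IsProbabilityMeasure P']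
    {H : Ω → ℕ} {H' : Ω' → ℕ} (hH : Measurable H) (hH' : Measurable H')
    (h : StochasticOrder (fun ω => (H ω : ℝ)) P (fun ω => (H' ω : ℝ)) P') (n : ℕ) :
    P'.real {ω | H' ω ≤ n} ≤ P.real {ω | H ω ≤ n} := by
  have h1 := ENNReal.toReal_mono (measure_ne_top _ _) (h n)
  have h2 : {ω | ((n : ℕ) : ℝ) < (H ω : ℝ)} = {ω | H ω ≤ n}ᶜ := by ext ω; simp
  have h3 : {ω | ((n : ℕ) : ℝ) < (H' ω : ℝ)} = {ω | H' ω ≤ n}ᶜ := by ext ω; simp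
  rw [h2, h3, ← measureReal_def, ← measureReal_def,
    probReal_compl_eq_one_sub (measurableSet_le hH measurable_const),
    probReal_compl_eq_one_sub (measurableSet_le hH' measurable_const)] at h1
  linarith

/-- A count whose generating function is `eta` of the residual tree rooted at `z` has the law of
the size of the cluster of `z`. -/
lemma measureReal_eq_coeff_sizePoly {T : SimpleGraph V} (hT : T.IsTree) {u v z : V}
    (huv : T.Adj u v) (hz : Joined (T.edgeFinset.erase s(u, v)) v z) {α : Sym2 V → I}
    {Ω : Type*} [MeasurableSpace Ω] {P : Measure Ω} [IsProbabilityMeasure P] {H : Ω → ℕ}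
    (hH : Measurable H)
    (hpgf : ∀ t ∈ Set.Icc (-1 : ℝ) 1, pgf H P t = eta (residual T u v) α z z (fun _ => t))
    (k : ℕ) :
    (P.map H).real {k} = (sizePoly α (T.edgeFinset.erase s(u, v)) z).coeff k := by
  have : IsProbabilityMeasure (P.map H) := Measure.isProbabilityMeasure_map hH.aemeasurable
  refine measureReal_eq_coeff (fun t ht => ?_) k
  rw [integral_map hH.aemeasurable (measurable_of_countable _).aestronglyMeasurable,
    eval_sizePoly, ← eta_residual_eq_perc hT huv α (fun _ => t) hz]
  exact hpgf t ht

end Comparison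

end TreeMRF

theorem mainTheorem2 {V : Type*} [Fintype V]
    (T T' : SimpleGraph V) (hT : T.IsTree) (hT' : T'.IsTree)
    (u v w : V) (huv : T.Adj u v) (huw : T'.Adj u w)
    (hE : T.edgeSet \ {s(u, v)} = T'.edgeSet \ {s(u, w)})
    (lam : ℝ≥0) (hlam : 0 < lam) (α α' : Sym2 V → I)
    (hα : ∀ e ∈ T.edgeSet \ {s(u, v)}, α e = α' e) (hαu : α s(u, v) = α' s(u, w))
    {Ω : Type*} [MeasurableSpace Ω] (P : Measure Ω) [IsProbabilityMeasure P]
    (N : V → Ω → ℕ) (hN : TreeMRF.IsMPMRF lam α T P N)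
    {Ω' : Type*} [MeasurableSpace Ω'] (P' : Measure Ω') [IsProbabilityMeasure P']
    (N' : V → Ω' → ℕ) (hN' : TreeMRF.IsMPMRF lam α' T' P' N')
    {Ωv : Type*} [MeasurableSpace Ωv] (Pv : Measure Ωv) [IsProbabilityMeasure Pv]
    (Hv : Ωv → ℕ) (hHv : Measurable Hv)
    (hHv_pgf : ∀ t ∈ Set.Icc (-1 : ℝ) 1,
      TreeMRF.pgf Hv Pv t = TreeMRF.eta (TreeMRF.residual T u v) α v v (fun _ => t))
    {Ωw : Type*} [MeasurableSpace Ωw] (Pw : Measure Ωw) [IsProbabilityMeasure Pw]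
    (Hw : Ωw → ℕ) (hHw : Measurable Hw)
    (hHw_pgf : ∀ t ∈ Set.Icc (-1 : ℝ) 1,
      TreeMRF.pgf Hw Pw t = TreeMRF.eta (TreeMRF.residual T u v) α w w (fun _ => t))
    (hst : TreeMRF.StochasticOrder (fun ω => (Hv ω : ℝ)) Pv (fun ω => (Hw ω : ℝ)) Pw) :
    TreeMRF.ConvexOrder (fun ω => ((∑ i, N i ω : ℕ) : ℝ)) P
      (fun ω => ((∑ i, N' i ω : ℕ) : ℝ)) P' := by
  classical
  set E := T.edgeFinset.erase s(u, v) with hEdef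
  have hTE : insert s(u, v) E = T.edgeFinset := Finset.insert_erase (by simpa using huv)
  have hE' : T'.edgeFinset.erase s(u, w) = E := by
    ext e
    have := Set.ext_iff.1 hE e
    simp only [Set.mem_sdiff, Set.mem_singleton_iff] at this
    simp only [hEdef, Finset.mem_erase, SimpleGraph.mem_edgeFinset]
    tauto
  have hTE' : insert s(u, w) E = T'.edgeFinset := by
    rw [← hE']
    exact Finset.insert_erase (by simpa using huw)
  have hv : ¬ TreeMRF.Joined E u v :=
    TreeMRF.forest_edgeFinset hT.isAcyclic u v (by simpa using huv)
  have hw : ¬ TreeMRF.Joined E u w := by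
    rw [← hE']
    exact TreeMRF.forest_edgeFinset hT'.isAcyclic u w (by simpa using huw)
  have hvw : TreeMRF.Joined E v w := by
    have h := TreeMRF.joined_edgeFinset.2 (hT.connected.preconnected v w)
    rw [← hTE, TreeMRF.joined_insert] at h
    rcases h with h | ⟨h, _⟩ | ⟨_, h⟩
    · exact h
    · exact absurd h.symm hv
    · exact absurd h hw
  have hαE : ∀ e ∈ E, α e = α' e := fun e he => by
    obtain ⟨h1, h2⟩ := Finset.mem_erase.1 he
    exact hα e ⟨by simpa using h2, h1⟩
  have hpv := TreeMRF.measureReal_eq_coeff_sizePoly hT huv (TreeMRF.Joined.refl _ v) hHv hHv_pgf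
  have hpw := TreeMRF.measureReal_eq_coeff_sizePoly hT huv hvw hHw hHw_pgf
  obtain ⟨q₁, hq₁, hq₁c⟩ := TreeMRF.exists_eq_X_sub_one_mul
    (p := TreeMRF.sizePoly α E u - 1) (by simp [TreeMRF.eval_one_sizePoly])
  obtain ⟨q₂, hq₂, hq₂c⟩ := TreeMRF.exists_eq_X_sub_one_mul
    (p := TreeMRF.sizePoly α E w - TreeMRF.sizePoly α E v) (by simp [TreeMRF.eval_one_sizePoly])
  have hq₁n : q₁ ∈ TreeMRF.nonnegPoly := by
    intro i
    have h := TreeMRF.sum_range_coeff_le (TreeMRF.sizePoly_mem_nonnegPoly α E u) (i + 1)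
    rw [TreeMRF.eval_one_sizePoly] at h
    have h1 : ∑ k ∈ Finset.range (i + 1), (1 : Polynomial ℝ).coeff k = 1 := by
      simp [Polynomial.coeff_one]
    simp only [hq₁c, Polynomial.coeff_sub, Finset.sum_sub_distrib, h1]
    linarith
  -- the coefficients of `q₂` are differences of the distribution functions of `Hv` and `Hw`
  have hq₂n : q₂ ∈ TreeMRF.nonnegPoly := by
    intro i
    have h := hst.measureReal_le_le hHv hHw i
    rw [← TreeMRF.sum_range_measureReal Pv hHv, ← TreeMRF.sum_range_measureReal Pw hHw] at h
    simp only [hpv, hpw] at h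
    simp only [hq₂c, Polynomial.coeff_sub, Finset.sum_sub_distrib]
    linarith
  have hC : ∀ a : I, (Polynomial.C (a : ℝ)) ∈ TreeMRF.nonnegPoly := fun a =>
    TreeMRF.C_mem_nonnegPoly a.2.1
  have hClam : Polynomial.C (lam : ℝ) ∈ TreeMRF.nonnegPoly := TreeMRF.C_mem_nonnegPoly lam.2
  have hdiff : Polynomial.C (lam : ℝ) * TreeMRF.clusterPoly α' T'.edgeFinset
      - Polynomial.C (lam : ℝ) * TreeMRF.clusterPoly α T.edgeFinset
      = (Polynomial.X - 1) ^ 2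
        * (Polynomial.C (lam : ℝ) * Polynomial.C (α s(u, v) : ℝ) * q₁ * q₂) := by
    rw [← mul_sub, ← hTE, ← hTE', TreeMRF.clusterPoly_insert_sub hv hw hαE hαu, hq₁, hq₂]
    ring
  have hM := hN.aemeasurable_sum
  have hM' := hN'.aemeasurable_sum
  have := Measure.isProbabilityMeasure_map hM
  have := Measure.isProbabilityMeasure_map hM'
  have hmeas : ∀ (μ : Measure ℕ) (f : ℕ → ℝ), AEStronglyMeasurable f μ := fun _ _ =>
    (measurable_of_countable _).aestronglyMeasurable
  intro φ hφ hi hi'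
  have h := TreeMRF.integral_le_of_pgf_eq_exp
    (mul_mem hClam (TreeMRF.clusterPoly_mem_nonnegPoly α T.edgeFinset))
    (mul_mem hClam (TreeMRF.clusterPoly_mem_nonnegPoly α' T'.edgeFinset))
    (mul_mem (mul_mem (mul_mem hClam (hC _)) hq₁n) hq₂n) hdiff
    (μ := P.map fun ω => ∑ i, N i ω) (μ' := P'.map fun ω => ∑ i, N' i ω)
    (fun t ht => by
      rw [integral_map hM (hmeas _ _)]
      exact hN.integral_pow_sum hT (abs_le.2 ht))
    (fun t ht => by
      rw [integral_map hM' (hmeas _ _)]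
      exact hN'.integral_pow_sum hT' (abs_le.2 ht))
    hφ ((integrable_map_measure (hmeas _ _) hM).2 hi)
    ((integrable_map_measure (hmeas _ _) hM').2 hi')
  rwa [integral_map hM (hmeas _ _), integral_map hM' (hmeas _ _)] at h
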